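/- For integers $n\ge k\ge 1$ let $[n]=\{1,\dots,n\}$ and let $\binom{[n]}{k}$ be the collection of all $k$-element subsets of $[n]$. A family $\mathcal F\subset\binom{[n]}{k}$ is called intersecting if $F\cap F'\neq\emptyset$ for all $F,F'\in\mathcal F$, and its triple diversity is $$\gamma_3(\mathcal F)=\min_{S\subset[n],\ |S|=3}\bigl|\{F\in\mathcal F : F\cap S=\emptyset\}\bigr|.$$ Theorem. Let $k\ge 4$ and $n\ge 71k^2$, and let $\mathcal F\subset\binom{[n]}{k}$ be an intersecting family. Then $$\gamma_3(\mathcal F)\le 3\binom{n-7}{k-4}+108\,k\binom{n-8}{k-5},$$ where a binomial coefficient with a negative lower index is $0$ (so that for $k=4$ the bound reads $\gamma_3(\mathcal F)\le 3$). -/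

import Mathlib

namespace TripleDiversity

/-- The subfamily of the members of `F` that are disjoint from the set `S`. -/
def avoiding {n : ℕ} (F : Finset (Finset (Fin n))) (S : Finset (Fin n)) :
    Finset (Finset (Fin n)) :=
  F.filter fun A => Disjoint A S

/-- The `l`-diversity: the minimum, over all `l`-subsets `S` of the ground set, of the number of
members of `F` that are disjoint from `S`. For `l ≤ n` the minimum is over a nonempty set of
natural numbers, so that it is attained. -/
noncomputable def diversity {n : ℕ} (l : ℕ) (F : Finset (Finset (Fin n))) : ℕ :=
  sInf ((fun S : Finset (Fin n) => (avoiding F S).card) '' {S | S.card = l})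

/-- The binomial coefficient with an integer lower index; it is `0` if that index is negative. -/
def binom (a : ℕ) (b : ℤ) : ℕ :=
  if b < 0 then 0 else a.choose b.toNat

end TripleDiversity

/-!
If some triple meets every member of the family, the diversity is `0`. Otherwise enlarge the
`k`-uniform intersecting family `F` to a maximal one (`exists_maximal_intersecting`). All its
transversals have at least four points, and by maximality any two transversals of at most `k` points
meet. Members are transversals, so there is a least `r`, with `4 ≤ r ≤ k`, such that no triple meets
all transversals of at most `r` points.

The members avoiding a triple `S` are counted by branching (`card_le_prod_of_branching`): a partial
set `X` that some transversal `T` misses is extended by one of the points of `T` off `S`. Taking `S`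
to meet all transversals of fewer than `r` points, transversals of at most `r` points serve while
`X` has fewer than `4` points, and members afterwards. For `r ≥ 6` this gives
`r ^ 4 * k ^ (r - 4) * (n - 3 - r).choose (k - r)`, which is at most `3 * (n - 7).choose (k - 4)` as
`n ≥ 71 * k ^ 2`. For `r = 5` a better choice of `S` saves enough in the first two steps.

For `r = 4` the transversals of four points form an intersecting family `G` of `4`-sets. Let `S` be
avoided by the fewest members of `G`. Minimality makes the first three branching factors `3` instead
of `4`, so that `3 * 3 * 3 * 4 * k = 108 * k` bounds the multiple of `(n - 8).choose (k - 5)` for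
the members containing no set of `G`. Each set of `G` avoiding `S` contributes at most
`(n - 7).choose (k - 4)` members, and the main term says that there are at most three such sets.

This is `not_spread`: in an intersecting family of `4`-sets some triple is avoided by at most three
members. Suppose that every triple is avoided by four or more. Then a triple lies in at most two
members (`triple_le_two`), and some triple `{x, y, z}` lies in exactly two, `{x, y, z, u}` and
`{x, y, z, v}` (`exists_triple_of_degree_two`). Every member avoiding `x, y, z` contains `u, v`, so
the link of `{u, v}` has at least four edges off `x, y, z`. By repeated use of `two_of_three` one
finds such a triple for which the link contains a `4`-cycle `a b c d` (`exists_cyc`). The members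
avoiding `u, v` contain `a, c` or `b, d`, and the way in which the two kinds have to meet is
contradictory (`not_cyc`).
-/

/-! ### Families of `4`-sets: counting the members that avoid a triple -/

namespace TripleDiversity

/-- An intersecting family of `4`-sets such that every three points are avoided by at least four of
its members. The points need not be distinct, so that the condition also covers pairs and single
points. -/
structure Spread {α : Type*} [DecidableEq α] (G : Finset (Finset α)) : Prop where
  card_eq : ∀ A ∈ G, A.card = 4
  inter : ∀ A ∈ G, ∀ B ∈ G, ∃ p ∈ A, p ∈ B
  four_le : ∀ x y z : α, 4 ≤ (G.filter fun A => x ∉ A ∧ y ∉ A ∧ z ∉ A).card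

/-- `Quad G a b c d` says that `{a, b, c, d}` is a member of `G`. When all members of `G` have four
points, this makes `a, b, c, d` distinct. The link of a pair `{u, v}` is the graph in which `a` and
`b` are joined if `Quad G u v a b`. -/
def Quad {α : Type*} [DecidableEq α] (G : Finset (Finset α)) (a b c d : α) : Prop :=
  ({a, b, c, d} : Finset α) ∈ G

theorem exists_three_not_of_subsingleton {α : Type*} {s : Finset (Finset α)} (hs : 4 ≤ s.card)
    (P : Finset α → Prop) (h : ∀ A ∈ s, ∀ B ∈ s, P A → P B → A = B) :
    ∃ A ∈ s, ∃ B ∈ s, ∃ C ∈ s, A ≠ B ∧ A ≠ C ∧ B ≠ C ∧ ¬ P A ∧ ¬ P B ∧ ¬ P C := by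
  classical
  have h1 : (s.filter P).card ≤ 1 := by
    rw [Finset.card_le_one]
    intro A hA B hB
    rw [Finset.mem_filter] at hA hB
    exact h A hA.1 B hB.1 hA.2 hB.2
  have h2 := Finset.card_filter_add_card_filter_not (s := s) P
  have h3 : 2 < (s.filter fun A => ¬ P A).card := by omega
  obtain ⟨A, B, C, hA, hB, hC, hAB, hAC, hBC⟩ := Finset.two_lt_card_iff.1 h3
  rw [Finset.mem_filter] at hA hB hC
  exact ⟨A, hA.1, B, hB.1, C, hC.1, hAB, hAC, hBC, hA.2, hB.2, hC.2⟩

theorem exists_two_not_of_card_le_two {α : Type*} {s : Finset (Finset α)} (hs : 4 ≤ s.card)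
    (P : Finset α → Prop)
    (h : ∀ A ∈ s, ∀ B ∈ s, ∀ C ∈ s, P A → P B → P C → A = B ∨ A = C ∨ B = C) :
    ∃ A ∈ s, ∃ B ∈ s, A ≠ B ∧ ¬ P A ∧ ¬ P B := by
  classical
  have h1 : (s.filter P).card ≤ 2 := by
    by_contra hc
    obtain ⟨A, B, C, hA, hB, hC, hAB, hAC, hBC⟩ := Finset.two_lt_card_iff.1 (not_le.1 hc)
    rw [Finset.mem_filter] at hA hB hC
    rcases h A hA.1 B hB.1 C hC.1 hA.2 hB.2 hC.2 with h | h | h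
    · exact hAB h
    · exact hAC h
    · exact hBC h
  have h2 := Finset.card_filter_add_card_filter_not (s := s) P
  have h3 : 1 < (s.filter fun A => ¬ P A).card := by omega
  obtain ⟨A, hA, B, hB, hAB⟩ := Finset.one_lt_card.1 h3
  rw [Finset.mem_filter] at hA hB
  exact ⟨A, hA.1, B, hB.1, hAB, hA.2, hB.2⟩

theorem exists_not_of_three_subsingletons {α : Type*} {s : Finset (Finset α)} (hs : 4 ≤ s.card)
    (P₁ P₂ P₃ : Finset α → Prop) (h₁ : ∀ A ∈ s, ∀ B ∈ s, P₁ A → P₁ B → A = B)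
    (h₂ : ∀ A ∈ s, ∀ B ∈ s, P₂ A → P₂ B → A = B) (h₃ : ∀ A ∈ s, ∀ B ∈ s, P₃ A → P₃ B → A = B) :
    ∃ A ∈ s, ¬ P₁ A ∧ ¬ P₂ A ∧ ¬ P₃ A := by
  obtain ⟨A, hA, B, hB, C, hC, hAB, hAC, hBC, nA, nB, nC⟩ :=
    exists_three_not_of_subsingleton hs P₁ h₁
  by_contra! hcon
  by_cases pA : P₂ A
  · have pB : ¬ P₂ B := fun h => hAB (h₂ A hA B hB pA h)
    have pC : ¬ P₂ C := fun h => hAC (h₂ A hA C hC pA h)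
    exact hBC (h₃ B hB C hC (hcon B hB nB pB) (hcon C hC nC pC))
  · by_cases pB : P₂ B
    · have pC : ¬ P₂ C := fun h => hBC (h₂ B hB C hC pB h)
      exact hAC (h₃ A hA C hC (hcon A hA nA pA) (hcon C hC nC pC))
    · exact hAB (h₃ A hA B hB (hcon A hA nA pA) (hcon B hB nB pB))

namespace Spread

variable {α : Type*} [DecidableEq α] {G : Finset (Finset α)}

/-- If at most one of the members avoiding `x, y, z` satisfies `P`, at least three do not. -/
theorem exists_three (hG : Spread G) (x y z : α) (P : Finset α → Prop)
    (h : ∀ A ∈ G, ∀ B ∈ G, x ∉ A → y ∉ A → z ∉ A → x ∉ B → y ∉ B → z ∉ B → P A → P B → A = B) :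
    ∃ A ∈ G, ∃ B ∈ G, ∃ C ∈ G, A ≠ B ∧ A ≠ C ∧ B ≠ C ∧ (x ∉ A ∧ y ∉ A ∧ z ∉ A) ∧
      (x ∉ B ∧ y ∉ B ∧ z ∉ B) ∧ (x ∉ C ∧ y ∉ C ∧ z ∉ C) ∧ ¬ P A ∧ ¬ P B ∧ ¬ P C := by
  have := exists_three_not_of_subsingleton (hG.four_le x y z) P (by
    intro A hA B hB
    rw [Finset.mem_filter] at hA hB
    exact h A hA.1 B hB.1 hA.2.1 hA.2.2.1 hA.2.2.2 hB.2.1 hB.2.2.1 hB.2.2.2)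
  simp only [Finset.mem_filter] at this
  obtain ⟨A, hA, B, hB, C, hC, hAB, hAC, hBC, nA, nB, nC⟩ := this
  exact ⟨A, hA.1, B, hB.1, C, hC.1, hAB, hAC, hBC, hA.2, hB.2, hC.2, nA, nB, nC⟩

/-- If at most two of the members avoiding `x, y, z` satisfy `P`, at least two of them do not. -/
theorem exists_two (hG : Spread G) (x y z : α) (P : Finset α → Prop)
    (h : ∀ A ∈ G, ∀ B ∈ G, ∀ C ∈ G, (x ∉ A ∧ y ∉ A ∧ z ∉ A) → (x ∉ B ∧ y ∉ B ∧ z ∉ B) →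
      (x ∉ C ∧ y ∉ C ∧ z ∉ C) → P A → P B → P C → A = B ∨ A = C ∨ B = C) :
    ∃ A ∈ G, ∃ B ∈ G, A ≠ B ∧ (x ∉ A ∧ y ∉ A ∧ z ∉ A) ∧
      (x ∉ B ∧ y ∉ B ∧ z ∉ B) ∧ ¬ P A ∧ ¬ P B := by
  have := exists_two_not_of_card_le_two (hG.four_le x y z) P (by
    intro A hA B hB C hC
    rw [Finset.mem_filter] at hA hB hC
    exact h A hA.1 B hB.1 C hC.1 hA.2 hB.2 hC.2)
  simp only [Finset.mem_filter] at this
  obtain ⟨A, hA, B, hB, hAB, nA, nB⟩ := this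
  exact ⟨A, hA.1, B, hB.1, hAB, hA.2, hB.2, nA, nB⟩

/-- If each of three properties holds for at most one of the members avoiding `x, y, z`, one of
these members has none of the properties. -/
theorem exists_one (hG : Spread G) (x y z : α) (P₁ P₂ P₃ : Finset α → Prop)
    (h₁ : ∀ A ∈ G, ∀ B ∈ G, (x ∉ A ∧ y ∉ A ∧ z ∉ A) → (x ∉ B ∧ y ∉ B ∧ z ∉ B) →
      P₁ A → P₁ B → A = B)
    (h₂ : ∀ A ∈ G, ∀ B ∈ G, (x ∉ A ∧ y ∉ A ∧ z ∉ A) → (x ∉ B ∧ y ∉ B ∧ z ∉ B) →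
      P₂ A → P₂ B → A = B)
    (h₃ : ∀ A ∈ G, ∀ B ∈ G, (x ∉ A ∧ y ∉ A ∧ z ∉ A) → (x ∉ B ∧ y ∉ B ∧ z ∉ B) →
      P₃ A → P₃ B → A = B) :
    ∃ A ∈ G, (x ∉ A ∧ y ∉ A ∧ z ∉ A) ∧ ¬ P₁ A ∧ ¬ P₂ A ∧ ¬ P₃ A := by
  have := exists_not_of_three_subsingletons (hG.four_le x y z) P₁ P₂ P₃
    (fun A hA B hB => by
      rw [Finset.mem_filter] at hA hB; exact h₁ A hA.1 B hB.1 hA.2 hB.2)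
    (fun A hA B hB => by
      rw [Finset.mem_filter] at hA hB; exact h₂ A hA.1 B hB.1 hA.2 hB.2)
    (fun A hA B hB => by
      rw [Finset.mem_filter] at hA hB; exact h₃ A hA.1 B hB.1 hA.2 hB.2)
  simp only [Finset.mem_filter] at this
  obtain ⟨A, hA, n⟩ := this
  exact ⟨A, hA.1, hA.2, n⟩

theorem exists_avoiding (hG : Spread G) (x y z : α) : ∃ A ∈ G, x ∉ A ∧ y ∉ A ∧ z ∉ A := by
  obtain ⟨A, hA, h, -⟩ := hG.exists_one x y z (fun _ => False) (fun _ => False) (fun _ => False)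
    (by simp) (by simp) (by simp)
  exact ⟨A, hA, h⟩

/-- Every member meets the member `{a, b, c, d}`. -/
theorem hit (hG : Spread G) {a b c d : α} (h : Quad G a b c d) {A : Finset α} (hA : A ∈ G) :
    a ∈ A ∨ b ∈ A ∨ c ∈ A ∨ d ∈ A := by
  obtain ⟨p, hp, hpA⟩ := hG.inter _ h _ hA
  simp only [Finset.mem_insert, Finset.mem_singleton] at hp
  rcases hp with rfl | rfl | rfl | rfl <;> simp [hpA]

theorem hit_quad (hG : Spread G) {a b c d p q r s : α} (h : Quad G a b c d)
    (h' : Quad G p q r s) :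
    (a = p ∨ a = q ∨ a = r ∨ a = s) ∨ (b = p ∨ b = q ∨ b = r ∨ b = s) ∨
      (c = p ∨ c = q ∨ c = r ∨ c = s) ∨ (d = p ∨ d = q ∨ d = r ∨ d = s) := by
  simpa using hG.hit h h'

theorem ne (hG : Spread G) {a b c d : α} (h : Quad G a b c d) :
    a ≠ b ∧ a ≠ c ∧ a ≠ d ∧ b ≠ c ∧ b ≠ d ∧ c ≠ d := by
  have := hG.card_eq _ h
  refine ⟨?_, ?_, ?_, ?_, ?_, ?_⟩ <;> rintro rfl <;> revert this <;> simp <;>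
    exact ne_of_lt (lt_of_le_of_lt Finset.card_le_three (by norm_num))

/-- A member that contains three given points consists of these and one more point. -/
theorem eq_insert (hG : Spread G) {A : Finset α} (hA : A ∈ G) {a b c : α} (ha : a ∈ A)
    (hb : b ∈ A) (hc : c ∈ A) (hab : a ≠ b) (hac : a ≠ c) (hbc : b ≠ c) :
    ∃ p, A = {a, b, c, p} ∧ Quad G a b c p := by
  have h3 : ({a, b, c} : Finset α).card = 3 := by
    rw [Finset.card_eq_three]; exact ⟨a, b, c, hab, hac, hbc, rfl⟩
  have hsub : ({a, b, c} : Finset α) ⊆ A := by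
    intro t
    simp only [Finset.mem_insert, Finset.mem_singleton]
    rintro (rfl | rfl | rfl) <;> assumption
  have h1 : (A \ {a, b, c}).card = 1 := by
    rw [Finset.card_sdiff_of_subset hsub, hG.card_eq A hA, h3]
  obtain ⟨p, hp⟩ := Finset.card_eq_one.1 h1
  have : A = {a, b, c, p} := by
    rw [← Finset.sdiff_union_of_subset hsub, hp]
    ext t; simp only [Finset.mem_union, Finset.mem_insert, Finset.mem_singleton]; grind
  exact ⟨p, this, by rw [Quad, ← this]; exact hA⟩

theorem eq_quad (hG : Spread G) {A : Finset α} (hA : A ∈ G) {a b c d : α} (ha : a ∈ A)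
    (hb : b ∈ A) (hc : c ∈ A) (hd : d ∈ A) (hab : a ≠ b) (hac : a ≠ c) (had : a ≠ d)
    (hbc : b ≠ c) (hbd : b ≠ d) (hcd : c ≠ d) : A = {a, b, c, d} := by
  obtain ⟨p, rfl, -⟩ := hG.eq_insert hA ha hb hc hab hac hbc
  simp only [Finset.mem_insert, Finset.mem_singleton] at hd
  rcases hd with h | h | h | h
  · exact absurd h.symm had
  · exact absurd h.symm hbd
  · exact absurd h.symm hcd
  · rw [h]

end Spread

theorem Quad.perm {α : Type*} [DecidableEq α] {G : Finset (Finset α)} {a b c d p q r s : α}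
    (h : Quad G a b c d)
    (e : ∀ t, (t = a ∨ t = b ∨ t = c ∨ t = d) ↔ (t = p ∨ t = q ∨ t = r ∨ t = s)) :
    Quad G p q r s := by
  have : ({p, q, r, s} : Finset α) = {a, b, c, d} := by
    ext t; simp only [Finset.mem_insert, Finset.mem_singleton]; exact (e t).symm
  rw [Quad, this]; exact h

namespace Spread

variable {α : Type*} [DecidableEq α] {G : Finset (Finset α)}

/-- A triple lies in at most two members. If `{a, b, c}` had the fourth points `p, q, r`, every
member avoiding `a, b, c` would contain `p, q, r`. The at least four remaining points of these
members would then fill each member that avoids `p, q, r`, so that there is only one such. -/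
theorem triple_le_two (hG : Spread G) {a b c p q r : α} (hp : Quad G a b c p)
    (hq : Quad G a b c q) (hr : Quad G a b c r) : p = q ∨ p = r ∨ q = r := by
  by_contra! hne
  obtain ⟨hpq, hpr, hqr⟩ := hne
  -- every member avoiding `a, b, c` contains `p, q, r`
  have hsub : ∀ A ∈ G, a ∉ A → b ∉ A → c ∉ A → p ∈ A ∧ q ∈ A ∧ r ∈ A := by
    intro A hA h1 h2 h3
    have := hG.hit hp hA
    have := hG.hit hq hA
    have := hG.hit hr hA
    grind
  let s := G.filter fun A => a ∉ A ∧ b ∉ A ∧ c ∉ A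
  let U := s.biUnion id \ {p, q, r}
  have hU : 4 ≤ U.card := by
    refine (hG.four_le a b c).trans ((Finset.card_le_card ?_).trans
      (Finset.card_image_le (s := U) (f := fun w => ({p, q, r, w} : Finset α))))
    intro A hA
    have hA' := (Finset.mem_filter.1 hA)
    obtain ⟨h1, h2, h3⟩ := hsub A hA'.1 hA'.2.1 hA'.2.2.1 hA'.2.2.2
    obtain ⟨w, rfl, hw⟩ := hG.eq_insert hA'.1 h1 h2 h3 hpq hpr hqr
    have := hG.ne hw
    refine Finset.mem_image.2 ⟨w, ?_, rfl⟩
    simp only [U, Finset.mem_sdiff, Finset.mem_biUnion, id]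
    refine ⟨⟨_, hA, by simp⟩, ?_⟩
    simp only [Finset.mem_insert, Finset.mem_singleton]
    grind
  have hB : ∀ B ∈ G, p ∉ B → q ∉ B → r ∉ B → B = U := by
    intro B hB h1 h2 h3
    symm
    refine Finset.eq_of_subset_of_card_le ?_ (by rw [hG.card_eq B hB]; exact hU)
    intro w hw
    simp only [U, Finset.mem_sdiff, Finset.mem_biUnion, id] at hw
    obtain ⟨⟨A, hA, hwA⟩, hw'⟩ := hw
    have hA' := (Finset.mem_filter.1 hA)
    obtain ⟨g1, g2, g3⟩ := hsub A hA'.1 hA'.2.1 hA'.2.2.1 hA'.2.2.2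
    simp only [Finset.mem_insert, Finset.mem_singleton, not_or] at hw'
    have := hG.eq_quad hA'.1 g1 g2 g3 hwA hpq hpr (Ne.symm hw'.1) hqr (Ne.symm hw'.2.1)
      (Ne.symm hw'.2.2)
    have hh := hG.hit (a := p) (b := q) (c := r) (d := w) (by rw [Quad, ← this]; exact hA'.1) hB
    grind
  obtain ⟨A, hA, B, hB', hne, h1, h2, -, -⟩ := hG.exists_two p q r (fun _ => False) (by simp)
  exact hne ((hB A hA h1.1 h1.2.1 h1.2.2).trans (hB B hB' h2.1 h2.2.1 h2.2.2).symm)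

theorem triple_mem_le_two (hG : Spread G) {a b c : α} (hab : a ≠ b) (hac : a ≠ c) (hbc : b ≠ c)
    {A B C : Finset α} (hA : A ∈ G) (hB : B ∈ G) (hC : C ∈ G) (hA' : a ∈ A ∧ b ∈ A ∧ c ∈ A)
    (hB' : a ∈ B ∧ b ∈ B ∧ c ∈ B) (hC' : a ∈ C ∧ b ∈ C ∧ c ∈ C) : A = B ∨ A = C ∨ B = C := by
  obtain ⟨p, rfl, hp⟩ := hG.eq_insert hA hA'.1 hA'.2.1 hA'.2.2 hab hac hbc
  obtain ⟨q, rfl, hq⟩ := hG.eq_insert hB hB'.1 hB'.2.1 hB'.2.2 hab hac hbc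
  obtain ⟨r, rfl, hr⟩ := hG.eq_insert hC hC'.1 hC'.2.1 hC'.2.2 hab hac hbc
  rcases hG.triple_le_two hp hq hr with rfl | rfl | rfl <;> simp

end Spread
end TripleDiversity

/-! ### Some triple lies in two members -/

namespace TripleDiversity
namespace Spread

variable {α : Type*} [DecidableEq α] {G : Finset (Finset α)}

/-- If no two members share a triple, a member is determined by three of its points. -/
theorem eq_of_linear (hG : Spread G)
    (hlin : ∀ x y z u v, Quad G x y z u → Quad G x y z v → u = v) {A B : Finset α} (hA : A ∈ G)
    (hB : B ∈ G) {a b c : α} (hab : a ≠ b) (hac : a ≠ c) (hbc : b ≠ c)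
    (hA' : a ∈ A ∧ b ∈ A ∧ c ∈ A) (hB' : a ∈ B ∧ b ∈ B ∧ c ∈ B) : A = B := by
  obtain ⟨p, rfl, hp⟩ := hG.eq_insert hA hA'.1 hA'.2.1 hA'.2.2 hab hac hbc
  obtain ⟨q, rfl, hq⟩ := hG.eq_insert hB hB'.1 hB'.2.1 hB'.2.2 hab hac hbc
  rw [hlin _ _ _ _ _ hp hq]

theorem quad_of_mem (hG : Spread G) {A : Finset α} (hA : A ∈ G) {a b c d : α} (ha : a ∈ A)
    (hb : b ∈ A) (hc : c ∈ A) (hd : d ∈ A) (hab : a ≠ b) (hac : a ≠ c) (had : a ≠ d)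
    (hbc : b ≠ c) (hbd : b ≠ d) (hcd : c ≠ d) : Quad G a b c d := by
  rw [Quad, ← hG.eq_quad hA ha hb hc hd hab hac had hbc hbd hcd]; exact hA

theorem eq_insert_pair (hG : Spread G) {A : Finset α} (hA : A ∈ G) {x y : α} (hx : x ∈ A)
    (hy : y ∈ A) (hxy : x ≠ y) : ∃ a b, A = {x, y, a, b} := by
  have hsub : ({x, y} : Finset α) ⊆ A := by
    intro t; simp only [Finset.mem_insert, Finset.mem_singleton]; rintro (rfl | rfl) <;> assumption
  have : (A \ {x, y}).card = 2 := by
    rw [Finset.card_sdiff_of_subset hsub, hG.card_eq A hA, Finset.card_pair hxy]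
  obtain ⟨a, b, -, hab⟩ := Finset.card_eq_two.1 this
  refine ⟨a, b, ?_⟩
  rw [← Finset.sdiff_union_of_subset hsub, hab]
  ext t; simp only [Finset.mem_union, Finset.mem_insert, Finset.mem_singleton]; grind

/-- Five members through a point `x` meet a member that misses `x` in its four points, so two of
them share a further point. -/
theorem exists_quads_sharing_pair [Nonempty α] (hG : Spread G)
    (hlin : ∀ x y z u v, Quad G x y z u → Quad G x y z v → u = v) :
    ∃ u v a b c d, Quad G u v a b ∧ Quad G u v c d ∧ a ≠ c ∧ a ≠ d ∧ b ≠ c ∧ b ≠ d := by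
  obtain ⟨x₀⟩ := ‹Nonempty α›
  obtain ⟨E, hE, -⟩ := hG.exists_avoiding x₀ x₀ x₀
  obtain ⟨x, y, z, t, -, -, -, -, -, -, rfl⟩ := Finset.card_eq_four.1 (hG.card_eq E hE)
  have hE' : Quad G x y z t := hE
  obtain ⟨B, hB, hxB, -, -⟩ := hG.exists_avoiding x x x
  let s := insert {x, y, z, t} (G.filter fun A => y ∉ A ∧ z ∉ A ∧ t ∉ A)
  have hs : ∀ A ∈ s, A ∈ G ∧ x ∈ A := by
    intro A hA
    rcases Finset.mem_insert.1 hA with rfl | hA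
    · exact ⟨hE, by simp⟩
    · have hA' := Finset.mem_filter.1 hA
      have := hG.hit hE' hA'.1
      exact ⟨hA'.1, by grind⟩
  have hcard : B.card < s.card := by
    rw [hG.card_eq B hB, Finset.card_insert_of_notMem (by simp)]
    have := hG.four_le y z t
    omega
  have hmeet : ∀ A : Finset α, ∃ p, A ∈ s → p ∈ A ∧ p ∈ B := by
    intro A
    by_cases hA : A ∈ s
    · obtain ⟨p, h1, h2⟩ := hG.inter A (hs A hA).1 B hB
      exact ⟨p, fun _ => ⟨h1, h2⟩⟩
    · exact ⟨x, fun h => absurd h hA⟩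
  choose f hf using hmeet
  obtain ⟨A, hA, A', hA', hne, heq⟩ := Finset.exists_ne_map_eq_of_card_lt_of_maps_to hcard
    (f := f) (fun A hA => (hf A hA).2)
  obtain ⟨p, hpA, hpA', hpB⟩ : ∃ p, p ∈ A ∧ p ∈ A' ∧ p ∈ B :=
    ⟨f A, (hf A hA).1, heq ▸ (hf A' hA').1, (hf A hA).2⟩
  have hpx : x ≠ p := by rintro rfl; exact hxB hpB
  obtain ⟨a, b, rfl⟩ := hG.eq_insert_pair (hs A hA).1 (hs A hA).2 hpA hpx
  obtain ⟨c, d, rfl⟩ := hG.eq_insert_pair (hs A' hA').1 (hs A' hA').2 hpA' hpx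
  have q1 : Quad G x p a b := (hs _ hA).1
  have q2 : Quad G x p c d := (hs _ hA').1
  have n1 := hG.ne q1
  have n2 := hG.ne q2
  have hcon : ∀ t, (t = a ∨ t = b) → (t = c ∨ t = d) → False := by
    intro t h1 h2
    exact hne (hG.eq_of_linear hlin (hs _ hA).1 (hs _ hA').1 (a := x) (b := p) (c := t)
      hpx (by grind) (by grind) (by simp; grind) (by simp; grind))
  exact ⟨x, p, a, b, c, d, q1, q2, by grind, by grind, by grind, by grind⟩

/-- The configuration that both linear cases lead to: a member avoiding `b, c, p` contains `q` and
one of `r, s`. -/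
theorem false_of_four_quads (hG : Spread G)
    (hlin : ∀ x y z u v, Quad G x y z u → Quad G x y z v → u = v) {a b c d p q r s : α}
    (h₁ : Quad G b c p q) (h₂ : Quad G b c r s) (h₃ : Quad G a d p r) (h₄ : Quad G a d q s)
    (hqr : ∀ A ∈ G, ∀ B ∈ G, ∀ C ∈ G, (b ∉ A ∧ c ∉ A ∧ p ∉ A) → (b ∉ B ∧ c ∉ B ∧ p ∉ B) →
      (b ∉ C ∧ c ∉ C ∧ p ∉ C) → (q ∈ A ∧ r ∈ A) → (q ∈ B ∧ r ∈ B) → (q ∈ C ∧ r ∈ C) →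
      A = B ∨ A = C ∨ B = C) : False := by
  obtain ⟨A, hA, B, hB, hne, avA, avB, nA, nB⟩ :=
    hG.exists_two b c p (fun A => q ∈ A ∧ r ∈ A) hqr
  have key : ∀ A ∈ G, (b ∉ A ∧ c ∉ A ∧ p ∉ A) → ¬ (q ∈ A ∧ r ∈ A) → A = {a, d, q, s} := by
    intro A hA av nA
    have := hG.hit h₁ hA
    have := hG.hit h₂ hA
    have := hG.hit h₃ hA
    have hq : q ∈ A := by grind
    have hs : s ∈ A := by grind
    have := hG.ne h₄
    rcases (show a ∈ A ∨ d ∈ A by grind) with h | h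
    · exact hG.eq_of_linear hlin hA h₄ (a := a) (b := q) (c := s) (by grind) (by grind) (by grind)
        ⟨h, hq, hs⟩ (by simp)
    · exact hG.eq_of_linear hlin hA h₄ (a := d) (b := q) (c := s) (by grind) (by grind) (by grind)
        ⟨h, hq, hs⟩ (by simp)
  exact hne ((key A hA avA nA).trans (key B hB avB nB).symm)

/-- Here `{a, b}`, `{c, d}`, `{e, f}` are three disjoint edges in the link of `{u, v}`. A member `A`
that avoids `u, v, a` and contains `e, f` would contain `b` and, say, `c`. Among the members that
avoid `u, v, a` at most one, `A` itself, could contain `c`, and at most two contain `d`. -/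
theorem not_both_of_three_quads (hG : Spread G)
    (hlin : ∀ x y z u v, Quad G x y z u → Quad G x y z v → u = v) {u v a b c d e f : α}
    (h₁ : Quad G u v a b) (h₂ : Quad G u v c d) (h₃ : Quad G u v e f)
    (hn : [a, b, c, d, e, f].Nodup) {A : Finset α} (hA : A ∈ G) (hu : u ∉ A) (hv : v ∉ A)
    (ha : a ∉ A) : ¬ (e ∈ A ∧ f ∈ A) := by
  rintro ⟨he, hf⟩
  simp only [List.nodup_cons, List.mem_cons, List.not_mem_nil, or_false, not_or, not_false_eq_true,
    List.nodup_nil, and_true] at hn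
  have key : ∀ c d, Quad G u v c d → b ≠ c → b ≠ d → c ≠ e → c ≠ f → d ≠ e → d ≠ f → c ∈ A →
      False := by
    intro c d h₂ hbc hbd hce hcf hde hdf hc
    have hit1 := fun {B : Finset α} (hB : B ∈ G) => hG.hit h₁ hB
    have hit2 := fun {B : Finset α} (hB : B ∈ G) => hG.hit h₂ hB
    have hit3 := fun {B : Finset α} (hB : B ∈ G) => hG.hit h₃ hB
    have hbA : b ∈ A := by have := hit1 hA; grind
    obtain ⟨B, hB, av, n1, n2, n3⟩ := hG.exists_one u v a (fun B => c ∈ B)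
      (fun B => d ∈ B ∧ e ∈ B) (fun B => d ∈ B ∧ f ∈ B)
      (by
        have : ∀ B ∈ G, (u ∉ B ∧ v ∉ B ∧ a ∉ B) → c ∈ B → B = A := by
          intro B hB av hc'
          have := hit1 hB
          have := hit3 hB
          rcases (show e ∈ B ∨ f ∈ B by grind) with h | h
          · exact hG.eq_of_linear hlin hB hA (a := b) (b := c) (c := e) (by grind) (by grind)
              (by grind) ⟨by grind, hc', h⟩ ⟨hbA, hc, he⟩
          · exact hG.eq_of_linear hlin hB hA (a := b) (b := c) (c := f) (by grind) (by grind)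
              (by grind) ⟨by grind, hc', h⟩ ⟨hbA, hc, hf⟩
        intro B hB C hC avB avC h h'
        rw [this B hB avB h, this C hC avC h'])
      (by
        intro B hB C hC avB avC h h'
        have := hit1 hB
        have := hit1 hC
        exact hG.eq_of_linear hlin hB hC (a := b) (b := d) (c := e) (by grind) (by grind)
              (by grind) ⟨by grind, h.1, h.2⟩ ⟨by grind, h'.1, h'.2⟩)
      (by
        intro B hB C hC avB avC h h'
        have := hit1 hB
        have := hit1 hC
        exact hG.eq_of_linear hlin hB hC (a := b) (b := d) (c := f) (by grind) (by grind)
              (by grind) ⟨by grind, h.1, h.2⟩ ⟨by grind, h'.1, h'.2⟩)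
    have := hit2 hB
    have := hit3 hB
    grind
  have := hG.hit h₂ hA
  rcases (show c ∈ A ∨ d ∈ A by grind) with h | h
  · exact key c d h₂ (by grind) (by grind) (by grind) (by grind) (by grind) (by grind) h
  · exact key d c (h₂.perm (by grind)) (by grind) (by grind) (by grind) (by grind) (by grind)
      (by grind) h

/-- The members avoiding `u, v, a` contain `b` and pick one point from each of `{c, d}` and
`{e, f}`. Each of the four choices is made by at most one of them, so each occurs. -/
theorem exists_quad_of_three_quads (hG : Spread G)
    (hlin : ∀ x y z u v, Quad G x y z u → Quad G x y z v → u = v) {u v a b c d e f : α}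
    (h₁ : Quad G u v a b) (h₂ : Quad G u v c d) (h₃ : Quad G u v e f)
    (hn : [a, b, c, d, e, f].Nodup) :
    ∃ p, Quad G b c e p ∧ p ≠ a ∧ p ≠ d ∧ p ≠ f ∧ p ≠ u ∧ p ≠ v := by
  have hn' : [a, b, e, f, c, d].Nodup := by
    simp only [List.nodup_cons, List.mem_cons, List.not_mem_nil, or_false, not_or,
      not_false_eq_true, List.nodup_nil, and_true] at hn ⊢
    grind
  have nef := fun {A : Finset α} (hA : A ∈ G) => hG.not_both_of_three_quads hlin h₁ h₂ h₃ hn hA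
  have ncd := fun {A : Finset α} (hA : A ∈ G) => hG.not_both_of_three_quads hlin h₁ h₃ h₂ hn' hA
  simp only [List.nodup_cons, List.mem_cons, List.not_mem_nil, or_false, not_or, not_false_eq_true,
    List.nodup_nil, and_true] at hn
  have hit1 := fun {B : Finset α} (hB : B ∈ G) => hG.hit h₁ hB
  have hit2 := fun {B : Finset α} (hB : B ∈ G) => hG.hit h₂ hB
  have hit3 := fun {B : Finset α} (hB : B ∈ G) => hG.hit h₃ hB
  have key : ∀ s t : α, b ≠ s → b ≠ t → s ≠ t → ∀ B ∈ G, ∀ C ∈ G, (u ∉ B ∧ v ∉ B ∧ a ∉ B) →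
      (u ∉ C ∧ v ∉ C ∧ a ∉ C) → (s ∈ B ∧ t ∈ B) → (s ∈ C ∧ t ∈ C) → B = C := by
    intro s t h1 h2 h3 B hB C hC avB avC h h'
    have := hit1 hB
    have := hit1 hC
    exact hG.eq_of_linear hlin hB hC (a := b) (b := s) (c := t) h1 h2 h3
      ⟨by grind, h.1, h.2⟩ ⟨by grind, h'.1, h'.2⟩
  obtain ⟨A, hA, av, n1, n2, n3⟩ := hG.exists_one u v a (fun B => c ∈ B ∧ f ∈ B)
      (fun B => d ∈ B ∧ e ∈ B) (fun B => d ∈ B ∧ f ∈ B)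
      (key c f (by grind) (by grind) (by grind)) (key d e (by grind) (by grind) (by grind))
      (key d f (by grind) (by grind) (by grind))
  have i1 := hit1 hA
  have i2 := hit2 hA
  have i3 := hit3 hA
  have hb : b ∈ A := by grind
  have hc : c ∈ A := by grind
  have he : e ∈ A := by grind
  have hd : d ∉ A := fun h => ncd hA av.1 av.2.1 av.2.2 ⟨hc, h⟩
  have hf : f ∉ A := fun h => nef hA av.1 av.2.1 av.2.2 ⟨he, h⟩
  obtain ⟨p, hAp, hp⟩ := hG.eq_insert hA hb hc he (by grind) (by grind) (by grind)
  have hpA : p ∈ A := by rw [hAp]; simp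
  refine ⟨p, hp, ?_, ?_, ?_, ?_, ?_⟩ <;> rintro rfl <;> grind

/-- The link of a pair does not contain three disjoint edges. The members given by
`exists_quad_of_three_quads` on the two sides `a` and `b` must meet in their fourth points, which
gives the configuration of `false_of_four_quads`. -/
theorem false_of_three_quads (hG : Spread G)
    (hlin : ∀ x y z u v, Quad G x y z u → Quad G x y z v → u = v) {u v a b c d e f : α}
    (h₁ : Quad G u v a b) (h₂ : Quad G u v c d) (h₃ : Quad G u v e f)
    (hn : [a, b, c, d, e, f].Nodup) : False := by
  have hn2 := hn
  simp only [List.nodup_cons, List.mem_cons, List.not_mem_nil, or_false, not_or, not_false_eq_true,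
    List.nodup_nil, and_true] at hn2
  have h₁' : Quad G u v b a := h₁.perm (by grind)
  have h₂' : Quad G u v d c := h₂.perm (by grind)
  have h₃' : Quad G u v f e := h₃.perm (by grind)
  obtain ⟨p₁, q₁, n₁⟩ := hG.exists_quad_of_three_quads hlin h₁ h₂ h₃ hn
  obtain ⟨p₂, q₂, n₂⟩ := hG.exists_quad_of_three_quads hlin h₁ h₂ h₃' (by simp; grind)
  obtain ⟨p₃, q₃, n₃⟩ := hG.exists_quad_of_three_quads hlin h₁' h₂' h₃' (by simp; grind)
  obtain ⟨p₄, q₄, n₄⟩ := hG.exists_quad_of_three_quads hlin h₁' h₂' h₃ (by simp; grind)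
  have e₁ : p₁ = p₃ := by
    have := hG.hit_quad q₁ q₃
    have := hG.ne q₁
    have := hG.ne q₃
    grind
  have e₂ : p₂ = p₄ := by
    have := hG.hit_quad q₂ q₄
    have := hG.ne q₂
    have := hG.ne q₄
    grind
  subst e₁ e₂
  have nef := fun {A : Finset α} (hA : A ∈ G) =>
    hG.not_both_of_three_quads hlin h₁' h₂ h₃ (by simp; grind) hA
  refine hG.false_of_four_quads hlin (a := a) (b := b) (c := c) (d := d) (p := p₁) (q := e)
    (r := f) (s := p₂) (q₁.perm (by grind)) q₂ (q₃.perm (by grind)) (q₄.perm (by grind)) ?_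
  -- the only member that avoids `b, c, p₁` and contains `e, f` is `{u, v, e, f}`
  have key : ∀ A ∈ G, (b ∉ A ∧ c ∉ A ∧ p₁ ∉ A) → e ∈ A ∧ f ∈ A → A = {u, v, e, f} := by
    intro A hA av hef
    have ne₃ := hG.ne h₃
    by_cases hu : u ∈ A
    · exact hG.eq_of_linear hlin hA h₃ (a := u) (b := e) (c := f) (by grind) (by grind) (by grind)
        ⟨hu, hef⟩ (by simp)
    by_cases hv : v ∈ A
    · exact hG.eq_of_linear hlin hA h₃ (a := v) (b := e) (c := f) (by grind) (by grind) (by grind)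
        ⟨hv, hef⟩ (by simp)
    exact absurd hef (nef hA hu hv av.1)
  intro A hA B hB C hC aA aB aC hA' hB' hC'
  left
  rw [key A hA aA hA', key B hB aB hB']

/-- If no two members share a triple, a pair lies in at most two members, because the edges of its
link are disjoint. -/
theorem pair_le_two_of_linear (hG : Spread G)
    (hlin : ∀ x y z u v, Quad G x y z u → Quad G x y z v → u = v) {s t : α} (hst : s ≠ t)
    {A B C : Finset α} (hA : A ∈ G) (hB : B ∈ G) (hC : C ∈ G) (hA' : s ∈ A ∧ t ∈ A)
    (hB' : s ∈ B ∧ t ∈ B) (hC' : s ∈ C ∧ t ∈ C) : A = B ∨ A = C ∨ B = C := by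
  by_contra! hne
  have key : ∀ {A B : Finset α}, A ∈ G → B ∈ G → s ∈ A ∧ t ∈ A → s ∈ B ∧ t ∈ B → A ≠ B →
      ∀ p, p ≠ s → p ≠ t → p ∈ A → p ∉ B := by
    intro A B hA hB hA' hB' hne p h1 h2 h3 h4
    exact hne (hG.eq_of_linear hlin hA hB hst h1.symm h2.symm ⟨hA'.1, hA'.2, h3⟩ ⟨hB'.1, hB'.2, h4⟩)
  have k1 := key hA hB hA' hB' hne.1
  have k2 := key hA hC hA' hC' hne.2.1
  have k3 := key hB hC hB' hC' hne.2.2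
  obtain ⟨a, b, rfl⟩ := hG.eq_insert_pair hA hA'.1 hA'.2 hst
  obtain ⟨c, d, rfl⟩ := hG.eq_insert_pair hB hB'.1 hB'.2 hst
  obtain ⟨e, f, rfl⟩ := hG.eq_insert_pair hC hC'.1 hC'.2 hst
  have n1 := hG.ne hA
  have n2 := hG.ne hB
  have n3 := hG.ne hC
  refine hG.false_of_three_quads hlin hA hB hC ?_
  simp only [Finset.mem_insert, Finset.mem_singleton, not_or] at k1 k2 k3
  have k1a := k1 a n1.2.1.symm n1.2.2.2.1.symm (by simp)
  have k1b := k1 b n1.2.2.1.symm n1.2.2.2.2.1.symm (by simp)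
  have k2a := k2 a n1.2.1.symm n1.2.2.2.1.symm (by simp)
  have k2b := k2 b n1.2.2.1.symm n1.2.2.2.2.1.symm (by simp)
  have k3c := k3 c n2.2.1.symm n2.2.2.2.1.symm (by simp)
  have k3d := k3 d n2.2.2.1.symm n2.2.2.2.2.1.symm (by simp)
  clear hne key k1 k2 k3 hA' hB' hC'
  simp only [List.nodup_cons, List.mem_cons, List.not_mem_nil, or_false, not_or, not_false_eq_true,
    List.nodup_nil, and_true]
  simp [*]

/-- Some triple lies in two members. Otherwise take disjoint edges `a b` and `c d` in the link of
`{u, v}`. The members avoiding `u, v, a` or `u, v, b` provide two members on `{b, c}` and two on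
`{a, d}`, which form the configuration of `false_of_four_quads`. -/
theorem exists_triple_of_degree_two [Nonempty α] (hG : Spread G) :
    ∃ x y z u v, u ≠ v ∧ Quad G x y z u ∧ Quad G x y z v := by
  by_contra! hcon
  have hlin : ∀ x y z u v, Quad G x y z u → Quad G x y z v → u = v := by
    intro x y z u v h1 h2
    by_contra hne
    exact hcon x y z u v hne h1 h2
  obtain ⟨u, v, a, b, c, d, h₁, h₂, hac, had, hbc, hbd⟩ := hG.exists_quads_sharing_pair hlin
  have ne₁ := hG.ne h₁
  have ne₂ := hG.ne h₂
  have key : ∀ a b c d, Quad G u v a b → Quad G u v c d → b ≠ d → ∃ A ∈ G, ∃ B ∈ G, A ≠ B ∧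
      (u ∉ A ∧ v ∉ A ∧ a ∉ A ∧ d ∉ A ∧ b ∈ A ∧ c ∈ A) ∧
      (u ∉ B ∧ v ∉ B ∧ a ∉ B ∧ d ∉ B ∧ b ∈ B ∧ c ∈ B) := by
    intro a b c d h₁ h₂ hbd
    have hb : ∀ A ∈ G, (u ∉ A ∧ v ∉ A ∧ a ∉ A) → b ∈ A := by
      intro A hA av
      have := hG.hit h₁ hA
      grind
    obtain ⟨A, hA, B, hB, hne, avA, avB, nA, nB⟩ := hG.exists_two u v a (fun A => d ∈ A) (by
      intro A hA B hB C hC aA aB aC hA' hB' hC'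
      exact hG.pair_le_two_of_linear hlin hbd hA hB hC ⟨hb A hA aA, hA'⟩ ⟨hb B hB aB, hB'⟩
        ⟨hb C hC aC, hC'⟩)
    have := hG.hit h₂ hA
    have := hG.hit h₂ hB
    have := hb A hA avA
    have := hb B hB avB
    exact ⟨A, hA, B, hB, hne, by grind, by grind⟩
  obtain ⟨A₁, hA₁, A₂, hA₂, hA, eA₁, eA₂⟩ := key a b c d h₁ h₂ hbd
  obtain ⟨B₁, hB₁, B₂, hB₂, hB, eB₁, eB₂⟩ :=
    key b a d c (h₁.perm (by grind)) (h₂.perm (by grind)) hac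
  have pick : ∀ A ∈ G, b ∈ A → c ∈ A → a ∉ A → d ∉ A → ∃ p q, A = {b, c, p, q} ∧ p ∈ B₁ := by
    intro A hA hb hc ha hd
    obtain ⟨p, q, rfl⟩ := hG.eq_insert_pair hA hb hc hbc
    have := hG.hit hA hB₁
    rcases (show p ∈ B₁ ∨ q ∈ B₁ by grind) with h | h
    · exact ⟨p, q, rfl, h⟩
    · exact ⟨q, p, by rw [Finset.pair_comm], h⟩
  obtain ⟨p, q, rfl, hp⟩ := pick A₁ hA₁ (by grind) (by grind) (by grind) (by grind)
  obtain ⟨r, s, rfl, hr⟩ := pick A₂ hA₂ (by grind) (by grind) (by grind) (by grind)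
  have m₁ := hG.ne hA₁
  have m₂ := hG.ne hA₂
  simp only [Finset.mem_insert, Finset.mem_singleton, not_or] at eA₁ eA₂
  have disj : ∀ t, (t = p ∨ t = q) → (t = r ∨ t = s) → False := by
    intro t h1 h2
    exact hA (hG.eq_of_linear hlin hA₁ hA₂ (a := b) (b := c) (c := t)
      hbc (by grind) (by grind) (by simp; grind) (by simp; grind))
  have disj' : ∀ t, t ≠ a → t ≠ d → t ∈ B₁ → t ∉ B₂ := by
    intro t h0 h0' h1 h2
    exact hB (hG.eq_of_linear hlin hB₁ hB₂ (a := a) (b := d) (c := t)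
      had h0.symm h0'.symm (by grind) (by grind))
  have hp₂ : p ∉ B₂ := disj' p (by grind) (by grind) hp
  have hr₂ : r ∉ B₂ := disj' r (by grind) (by grind) hr
  have q₃ := hG.quad_of_mem hB₁ (a := a) (b := d) (c := p) (d := r) (by grind) (by grind) hp hr
    had (by grind) (by grind) (by grind) (by grind) (by grind)
  have i₁ := hG.hit hA₁ hB₂
  have i₂ := hG.hit hA₂ hB₂
  have q₄ := hG.quad_of_mem hB₂ (a := a) (b := d) (c := q) (d := s) (by grind) (by grind)
    (by grind) (by grind) had (by grind) (by grind) (by grind) (by grind) (by grind)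
  refine hG.false_of_four_quads hlin hA₁ hA₂ q₃ q₄ ?_
  intro A hA B hB C hC _ _ _ hA' hB' hC'
  exact hG.pair_le_two_of_linear hlin (by grind) hA hB hC hA' hB' hC'

end Spread
end TripleDiversity

/-! ### A `4`-cycle in the link of a pair -/

namespace TripleDiversity

/-- The triple `{x, y, z}` lies in the two members `{x, y, z, u}` and `{x, y, z, v}`, and the link
of the pair `{u, v}` contains a `4`-cycle `a b c d` that avoids `x, y, z`. -/
structure Cyc {α : Type*} [DecidableEq α] (G : Finset (Finset α)) (x y z u v a b c d : α) :
    Prop where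
  xyzu : Quad G x y z u
  xyzv : Quad G x y z v
  uvab : Quad G u v a b
  uvbc : Quad G u v b c
  uvcd : Quad G u v c d
  uvda : Quad G u v d a
  hac : a ≠ c
  hbd : b ≠ d
  hx : x ≠ a ∧ x ≠ b ∧ x ≠ c ∧ x ≠ d
  hy : y ≠ a ∧ y ≠ b ∧ y ≠ c ∧ y ≠ d
  hz : z ≠ a ∧ z ≠ b ∧ z ≠ c ∧ z ≠ d

namespace Spread

variable {α : Type*} [DecidableEq α] {G : Finset (Finset α)}

/-- A path `a b c` and an edge `d e` in the link of `{u, v}` force `d` to be joined to two of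
`x, y, z` in the link of `{a, c}`. A member that avoids `u, v, b` contains `a` and `c`, one of
`x, y, z`, and one of `d, e`. At most two contain the triple `a c e`, so two contain `a c d`. -/
theorem two_of_three (hG : Spread G) {x y z u v a b c d e : α} (h₁ : Quad G x y z u)
    (h₃ : Quad G u v b a) (h₄ : Quad G u v b c) (h₅ : Quad G u v d e)
    (hn : a ≠ c ∧ d ≠ a ∧ d ≠ c ∧ e ≠ a ∧ e ≠ c) (hx : x ≠ a ∧ x ≠ c ∧ x ≠ d)
    (hy : y ≠ a ∧ y ≠ c ∧ y ≠ d) (hz : z ≠ a ∧ z ≠ c ∧ z ≠ d) :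
    (Quad G a c d x ∧ Quad G a c d y) ∨ (Quad G a c d x ∧ Quad G a c d z) ∨
      (Quad G a c d y ∧ Quad G a c d z) := by
  have key : ∀ A ∈ G, (u ∉ A ∧ v ∉ A ∧ b ∉ A) → a ∈ A ∧ c ∈ A ∧ (x ∈ A ∨ y ∈ A ∨ z ∈ A) ∧
      (d ∈ A ∨ e ∈ A) := by
    intro A hA av
    have := hG.hit h₁ hA
    have := hG.hit h₃ hA
    have := hG.hit h₄ hA
    have := hG.hit h₅ hA
    grind
  obtain ⟨A, hA, B, hB, hne, avA, avB, nA, nB⟩ := hG.exists_two u v b (fun A => e ∈ A) (by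
    intro A hA B hB C hC aA aB aC hA' hB' hC'
    have kA := key A hA aA
    have kB := key B hB aB
    have kC := key C hC aC
    exact hG.triple_mem_le_two (a := a) (b := c) (c := e) hn.1 hn.2.2.2.1.symm hn.2.2.2.2.symm
      hA hB hC ⟨kA.1, kA.2.1, hA'⟩ ⟨kB.1, kB.2.1, hB'⟩ ⟨kC.1, kC.2.1, hC'⟩)
  have fin : ∀ A ∈ G, (u ∉ A ∧ v ∉ A ∧ b ∉ A) → e ∉ A → ∃ t, A = {a, c, d, t} ∧
      Quad G a c d t ∧ (t = x ∨ t = y ∨ t = z) := by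
    intro A hA av nA
    obtain ⟨ha, hc, ht, hd⟩ := key A hA av
    obtain ⟨t, rfl, hq⟩ := hG.eq_insert hA ha hc (hd.resolve_right nA) hn.1 hn.2.1.symm
      hn.2.2.1.symm
    simp only [Finset.mem_insert, Finset.mem_singleton] at ht
    exact ⟨t, rfl, hq, by grind⟩
  obtain ⟨s, rfl, hs, hs'⟩ := fin A hA avA nA
  obtain ⟨t, rfl, ht, ht'⟩ := fin B hB avB nB
  have hst : s ≠ t := by rintro rfl; exact hne rfl
  rcases hs' with rfl | rfl | rfl <;> rcases ht' with rfl | rfl | rfl <;> simp_all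

/-- The members avoiding `x, y, z` all contain `u, v`. A member `B` that misses `u, v` contains one
of `x, y, z`, so that it meets those at least four members in at most three points. Two of them thus
share a third point `b`. -/
theorem exists_link_path (hG : Spread G) {x y z u v : α} (h₁ : Quad G x y z u)
    (h₂ : Quad G x y z v) (huv : u ≠ v) :
    ∃ a b c, Quad G u v b a ∧ Quad G u v b c ∧ a ≠ c ∧ (x ≠ a ∧ x ≠ b ∧ x ≠ c) ∧
      (y ≠ a ∧ y ≠ b ∧ y ≠ c) ∧ (z ≠ a ∧ z ≠ b ∧ z ≠ c) := by
  obtain ⟨B, hB, hu, hv, -⟩ := hG.exists_avoiding u v v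
  have hcard : (B \ {x, y, z}).card < (G.filter fun A => x ∉ A ∧ y ∉ A ∧ z ∉ A).card := by
    refine lt_of_lt_of_le ?_ (hG.four_le x y z)
    rw [← hG.card_eq B hB]
    refine Finset.card_lt_card ⟨Finset.sdiff_subset, fun h => ?_⟩
    have := hG.hit h₁ hB
    have h' := fun t (ht : t ∈ B) => (Finset.mem_sdiff.1 (h ht)).2
    simp only [Finset.mem_insert, Finset.mem_singleton] at h'
    grind
  have huv' : ∀ A ∈ G, (x ∉ A ∧ y ∉ A ∧ z ∉ A) → u ∈ A ∧ v ∈ A := by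
    intro A hA av
    have := hG.hit h₁ hA
    have := hG.hit h₂ hA
    grind
  have hmeet : ∀ A : Finset α, ∃ p, A ∈ G → p ∈ A ∧ p ∈ B := by
    intro A
    by_cases hA : A ∈ G
    · obtain ⟨p, h1, h2⟩ := hG.inter A hA B hB
      exact ⟨p, fun _ => ⟨h1, h2⟩⟩
    · exact ⟨x, fun h => absurd h hA⟩
  choose f hf using hmeet
  obtain ⟨A, hA, A', hA', hne, heq⟩ := Finset.exists_ne_map_eq_of_card_lt_of_maps_to hcard
    (f := f) (fun A hA => by
      have hA' := Finset.mem_filter.1 hA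
      have := hf A hA'.1
      simp only [Finset.coe_sdiff, Set.mem_sdiff, Finset.mem_coe, Finset.mem_insert,
        Finset.mem_singleton]
      grind)
  rw [Finset.mem_filter] at hA hA'
  obtain ⟨b, hbA, hbA', hbB⟩ : ∃ p, p ∈ A ∧ p ∈ A' ∧ p ∈ B :=
    ⟨f A, (hf A hA.1).1, heq ▸ (hf A' hA'.1).1, (hf A hA.1).2⟩
  have hub : u ≠ b := by rintro rfl; exact hu hbB
  have hvb : v ≠ b := by rintro rfl; exact hv hbB
  obtain ⟨a, rfl, qa⟩ := hG.eq_insert hA.1 (huv' A hA.1 hA.2).1 (huv' A hA.1 hA.2).2 hbA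
    huv hub hvb
  obtain ⟨c, rfl, qc⟩ := hG.eq_insert hA'.1 (huv' A' hA'.1 hA'.2).1 (huv' A' hA'.1 hA'.2).2 hbA'
    huv hub hvb
  have hac : a ≠ c := by rintro rfl; exact hne rfl
  have h1 := hA.2
  have h2 := hA'.2
  simp only [Finset.mem_insert, Finset.mem_singleton, not_or] at h1 h2
  exact ⟨a, b, c, qa, qc, hac, by grind, by grind, by grind⟩

/-- The link of `{u, v}` contains a `4`-cycle, or a path with two edges and an edge disjoint from
it. -/
theorem cyc_or_exists_disjoint_edge (hG : Spread G) {x y z u v : α} (h₁ : Quad G x y z u)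
    (h₂ : Quad G x y z v) (huv : u ≠ v) :
    (∃ a b c d, Cyc G x y z u v a b c d) ∨
    ∃ a b c d e, Quad G u v b a ∧ Quad G u v b c ∧ Quad G u v d e ∧ a ≠ c ∧
      (d ≠ a ∧ d ≠ b ∧ d ≠ c) ∧ (e ≠ a ∧ e ≠ b ∧ e ≠ c) ∧
      (x ≠ a ∧ x ≠ b ∧ x ≠ c ∧ x ≠ d ∧ x ≠ e) ∧ (y ≠ a ∧ y ≠ b ∧ y ≠ c ∧ y ≠ d ∧ y ≠ e) ∧
      (z ≠ a ∧ z ≠ b ∧ z ≠ c ∧ z ≠ d ∧ z ≠ e) := by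
  obtain ⟨a, b, c, qa, qc, hac, hx, hy, hz⟩ := hG.exists_link_path h₁ h₂ huv
  have na := hG.ne qa
  have nc := hG.ne qc
  have huv' : ∀ A ∈ G, (x ∉ A ∧ y ∉ A ∧ z ∉ A) → u ∈ A ∧ v ∈ A := by
    intro A hA av
    have := hG.hit h₁ hA
    have := hG.hit h₂ hA
    grind
  obtain ⟨A, hA, B, hB, hne, avA, avB, nA, nB⟩ := hG.exists_two x y z (fun A => b ∈ A) (by
    intro A hA B hB C hC aA aB aC hA' hB' hC'
    have kA := huv' A hA aA
    have kB := huv' B hB aB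
    have kC := huv' C hC aC
    exact hG.triple_mem_le_two (a := u) (b := v) (c := b) huv na.2.1 na.2.2.2.1
      hA hB hC ⟨kA.1, kA.2, hA'⟩ ⟨kB.1, kB.2, hB'⟩ ⟨kC.1, kC.2, hC'⟩)
  -- a member that avoids `a` and `c` provides the disjoint edge
  by_cases hfree : ∃ D ∈ G, (x ∉ D ∧ y ∉ D ∧ z ∉ D) ∧ b ∉ D ∧ a ∉ D ∧ c ∉ D
  · right
    obtain ⟨D, hD, avD, hb, ha, hc⟩ := hfree
    obtain ⟨d, e, rfl⟩ := hG.eq_insert_pair hD (huv' D hD avD).1 (huv' D hD avD).2 huv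
    simp only [Finset.mem_insert, Finset.mem_singleton, not_or] at avD ha hb hc
    exact ⟨a, b, c, d, e, qa, qc, hD, hac, by grind, by grind, by grind, by grind, by grind⟩
  have hac' : ∀ D ∈ G, (x ∉ D ∧ y ∉ D ∧ z ∉ D) → b ∉ D → a ∈ D ∨ c ∈ D := by
    intro D hD av hb
    by_contra! h
    exact hfree ⟨D, hD, av, hb, h.1, h.2⟩
  have noA : ¬ (a ∈ A ∧ a ∈ B) := by
    rintro ⟨h1, h2⟩
    have := hG.triple_mem_le_two (a := u) (b := v) (c := a) huv (by grind) (by grind) hA hB qa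
      ⟨(huv' A hA avA).1, (huv' A hA avA).2, h1⟩ ⟨(huv' B hB avB).1, (huv' B hB avB).2, h2⟩
      (by simp)
    rcases this with h | rfl | rfl
    · exact hne h
    · simp at nA
    · simp at nB
  have noC : ¬ (c ∈ A ∧ c ∈ B) := by
    rintro ⟨h1, h2⟩
    have := hG.triple_mem_le_two (a := u) (b := v) (c := c) huv (by grind) (by grind) hA hB qc
      ⟨(huv' A hA avA).1, (huv' A hA avA).2, h1⟩ ⟨(huv' B hB avB).1, (huv' B hB avB).2, h2⟩
      (by simp)
    rcases this with h | rfl | rfl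
    · exact hne h
    · simp at nA
    · simp at nB
  have main : ∀ A ∈ G, ∀ B ∈ G, (x ∉ A ∧ y ∉ A ∧ z ∉ A) → (x ∉ B ∧ y ∉ B ∧ z ∉ B) → b ∉ A →
      b ∉ B → a ∈ A → c ∈ B → a ∉ B → c ∉ A →
      (∃ a b c d, Cyc G x y z u v a b c d) ∨
      ∃ a b c d e, Quad G u v b a ∧ Quad G u v b c ∧ Quad G u v d e ∧ a ≠ c ∧
      (d ≠ a ∧ d ≠ b ∧ d ≠ c) ∧ (e ≠ a ∧ e ≠ b ∧ e ≠ c) ∧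
      (x ≠ a ∧ x ≠ b ∧ x ≠ c ∧ x ≠ d ∧ x ≠ e) ∧ (y ≠ a ∧ y ≠ b ∧ y ≠ c ∧ y ≠ d ∧ y ≠ e) ∧
      (z ≠ a ∧ z ≠ b ∧ z ≠ c ∧ z ≠ d ∧ z ≠ e) := by
    intro A hA B hB avA avB nA nB ha hc ha' hc'
    obtain ⟨d, rfl, qd⟩ := hG.eq_insert hA (huv' A hA avA).1 (huv' A hA avA).2 ha huv
      (by grind) (by grind)
    obtain ⟨e, rfl, qe⟩ := hG.eq_insert hB (huv' B hB avB).1 (huv' B hB avB).2 hc huv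
      (by grind) (by grind)
    have nd := hG.ne qd
    have nee := hG.ne qe
    simp only [Finset.mem_insert, Finset.mem_singleton, not_or] at avA avB nA nB ha' hc'
    by_cases hde : d = e
    · subst hde
      exact Or.inl ⟨a, b, c, d, h₁, h₂, qa.perm (by grind), qc, qe, qd.perm (by grind), hac,
        by grind, by grind, by grind, by grind⟩
    · exact Or.inr ⟨b, a, d, c, e, qa.perm (by grind), qd, qe, by grind, by grind, by grind,
        by grind, by grind, by grind⟩
  have hA' := hac' A hA avA nA
  have hB' := hac' B hB avB nB
  by_cases ha : a ∈ A
  · exact main A hA B hB avA avB nA nB ha (by grind) (by grind) (by grind)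
  · exact main B hB A hA avB avA nB nA (by grind) (by grind) (by grind) (by grind)

/-- The case of `exists_cyc_of_path` in which `e` is joined to `u` and `b` in the link of `{x, y}`:
applying `two_of_three` once more gives a `4`-cycle `z a v c` in the link of `{b, u}`. -/
theorem exists_cyc_of_path_of_common (hG : Spread G) {x y z u v a b c d e : α} (huv : u ≠ v)
    (h₂ : Quad G x y z v) (h₃ : Quad G u v b a) (h₄ : Quad G u v b c)
    (g₁ : Quad G a c d x) (g₃ : Quad G a c e y)
    (k₁ : Quad G x y e u) (k₂ : Quad G x y e b)
    (hac : a ≠ c) (hd : d ≠ a ∧ d ≠ b ∧ d ≠ c) (he : e ≠ a ∧ e ≠ b ∧ e ≠ c)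
    (hx : x ≠ a ∧ x ≠ b ∧ x ≠ c ∧ x ≠ d ∧ x ≠ e) (hy : y ≠ a ∧ y ≠ b ∧ y ≠ c ∧ y ≠ d ∧ y ≠ e)
    (hz : z ≠ a ∧ z ≠ b ∧ z ≠ c ∧ z ≠ d ∧ z ≠ e ∧ z ≠ u) (hu : u ≠ d) (hv : v ≠ e) (hde : d ≠ e) :
    ∃ x y z u v a b c d, Cyc G x y z u v a b c d := by
  have := hG.ne h₂
  have := hG.ne h₃
  have := hG.ne h₄
  have := hG.ne k₁
  have := hG.ne k₂
  have hd' : ¬ Quad G b u z d := by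
    intro h
    have := hG.hit_quad h g₃
    grind
  rcases hG.two_of_three (x := a) (y := c) (z := d) (u := x) (v := y) (a := b) (b := e) (c := u)
      (d := z) (e := v) g₁ k₂ k₁ (h₂.perm (by grind)) (by grind) (by grind) (by grind) (by grind)
    with ⟨q₁, q₂⟩ | ⟨-, q⟩ | ⟨-, q⟩
  · exact ⟨x, y, e, b, u, z, a, v, c, k₂, k₁, q₁, h₃.perm (by grind), h₄.perm (by grind),
      q₂.perm (by grind), by grind, hac, by grind, by grind, by grind⟩
  · exact absurd q hd'
  · exact absurd q hd'

/-- The case in which `d` and `e` are joined to different pairs `x y` and `y z` in the link of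
`{a, c}`. In the link of `{x, y}` the point `e` is then joined to two of `u, v, b`, and the pair
`u, v` closes a `4`-cycle there. -/
theorem exists_cyc_of_path (hG : Spread G) {x y z u v a b c d e : α} (huv : u ≠ v)
    (h₁ : Quad G x y z u) (h₂ : Quad G x y z v) (h₃ : Quad G u v b a) (h₄ : Quad G u v b c)
    (h₅ : Quad G u v d e)
    (g₁ : Quad G a c d x) (g₂ : Quad G a c d y) (g₃ : Quad G a c e y) (g₄ : Quad G a c e z)
    (hac : a ≠ c) (hd : d ≠ a ∧ d ≠ b ∧ d ≠ c) (he : e ≠ a ∧ e ≠ b ∧ e ≠ c)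
    (hx : x ≠ a ∧ x ≠ b ∧ x ≠ c ∧ x ≠ d ∧ x ≠ e) (hy : y ≠ a ∧ y ≠ b ∧ y ≠ c ∧ y ≠ d ∧ y ≠ e)
    (hz : z ≠ a ∧ z ≠ b ∧ z ≠ c ∧ z ≠ d ∧ z ≠ e) :
    ∃ x y z u v a b c d, Cyc G x y z u v a b c d := by
  have := hG.ne h₁
  have := hG.ne h₂
  have := hG.ne h₃
  have := hG.ne h₄
  have := hG.ne h₅
  rcases hG.two_of_three (x := u) (y := v) (z := b) (u := a) (v := c) (a := x) (b := d) (c := y)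
      (d := e) (e := z) (h₃.perm (by grind)) g₁ g₂ g₄ (by grind) (by grind) (by grind) (by grind)
    with ⟨q₁, q₂⟩ | ⟨q₁, q₂⟩ | ⟨q₁, q₂⟩
  · exact ⟨a, c, d, x, y, u, z, v, e, g₁, g₂, h₁.perm (by grind), h₂, q₂.perm (by grind), q₁,
      by grind, by grind, by grind, by grind, by grind⟩
  · exact hG.exists_cyc_of_path_of_common huv h₂ h₃ h₄ g₁ g₃ q₁ q₂ hac hd he hx hy (by grind)
      (by grind) (by grind) (by grind)
  · exact hG.exists_cyc_of_path_of_common huv.symm h₁ (h₃.perm (by grind)) (h₄.perm (by grind))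
      g₁ g₃ q₁ q₂ hac hd he hx hy (by grind) (by grind) (by grind) (by grind)

/-- If `d` is joined to `x` and `y` in the link of `{a, c}`, so is `e`, which gives a `4`-cycle
`d x e y` in that link, or `exists_cyc_of_path` applies. -/
theorem exists_cyc_of_pair (hG : Spread G) {x y z u v a b c d e : α} (huv : u ≠ v)
    (h₁ : Quad G x y z u) (h₂ : Quad G x y z v) (h₃ : Quad G u v b a) (h₄ : Quad G u v b c)
    (h₅ : Quad G u v d e) (g₁ : Quad G a c d x) (g₂ : Quad G a c d y)
    (hac : a ≠ c) (hd : d ≠ a ∧ d ≠ b ∧ d ≠ c) (he : e ≠ a ∧ e ≠ b ∧ e ≠ c)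
    (hx : x ≠ a ∧ x ≠ b ∧ x ≠ c ∧ x ≠ d ∧ x ≠ e) (hy : y ≠ a ∧ y ≠ b ∧ y ≠ c ∧ y ≠ d ∧ y ≠ e)
    (hz : z ≠ a ∧ z ≠ b ∧ z ≠ c ∧ z ≠ d ∧ z ≠ e) :
    ∃ x y z u v a b c d, Cyc G x y z u v a b c d := by
  have := hG.ne h₁
  have := hG.ne h₂
  have := hG.ne h₅
  rcases hG.two_of_three (d := e) (e := d) h₁ h₃ h₄ (h₅.perm (by grind)) (by grind) (by grind)
    (by grind) (by grind) with ⟨q₁, q₂⟩ | ⟨q₁, q₂⟩ | ⟨q₁, q₂⟩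
  · exact ⟨u, v, b, a, c, d, x, e, y, h₃, h₄, g₁, q₁.perm (by grind), q₂, g₂.perm (by grind),
      by grind, by grind, by grind, by grind, by grind⟩
  · exact hG.exists_cyc_of_path huv (h₁.perm (by grind)) (h₂.perm (by grind)) h₃ h₄ h₅ g₂ g₁ q₁ q₂
      hac hd he hy hx hz
  · exact hG.exists_cyc_of_path huv h₁ h₂ h₃ h₄ h₅ g₁ g₂ q₁ q₂ hac hd he hx hy hz

theorem exists_cyc [Nonempty α] (hG : Spread G) :
    ∃ x y z u v a b c d, Cyc G x y z u v a b c d := by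
  obtain ⟨x, y, z, u, v, huv, h₁, h₂⟩ := hG.exists_triple_of_degree_two
  rcases hG.cyc_or_exists_disjoint_edge h₁ h₂ huv with ⟨a, b, c, d, h⟩ |
    ⟨a, b, c, d, e, h₃, h₄, h₅, hac, hd, he, hx, hy, hz⟩
  · exact ⟨x, y, z, u, v, a, b, c, d, h⟩
  · rcases hG.two_of_three h₁ h₃ h₄ h₅ (by grind) (by grind) (by grind) (by grind) with
      ⟨q₁, q₂⟩ | ⟨q₁, q₂⟩ | ⟨q₁, q₂⟩
    · exact hG.exists_cyc_of_pair huv h₁ h₂ h₃ h₄ h₅ q₁ q₂ hac hd he hx hy hz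
    · exact hG.exists_cyc_of_pair huv (h₁.perm (by grind)) (h₂.perm (by grind)) h₃ h₄ h₅ q₁ q₂
        hac hd he hx hz hy
    · exact hG.exists_cyc_of_pair huv (h₁.perm (by grind)) (h₂.perm (by grind)) h₃ h₄ h₅ q₁ q₂
        hac hd he hy hz hx

end Spread
end TripleDiversity

/-! ### Edges between the `4`-cycle and the triple -/

namespace TripleDiversity

namespace Cyc

variable {α : Type*} [DecidableEq α] {G : Finset (Finset α)} {x y z u v a b c d : α}

theorem rotate (h : Cyc G x y z u v a b c d) : Cyc G x y z u v b c d a where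
  xyzu := h.xyzu
  xyzv := h.xyzv
  uvab := h.uvbc
  uvbc := h.uvcd
  uvcd := h.uvda
  uvda := h.uvab
  hac := h.hbd
  hbd := h.hac.symm
  hx := by have := h.hx; grind
  hy := by have := h.hy; grind
  hz := by have := h.hz; grind

theorem reflect (h : Cyc G x y z u v a b c d) : Cyc G x y z u v a d c b where
  xyzu := h.xyzu
  xyzv := h.xyzv
  uvab := h.uvda.perm (by grind)
  uvbc := h.uvcd.perm (by grind)
  uvcd := h.uvbc.perm (by grind)
  uvda := h.uvab.perm (by grind)
  hac := h.hac
  hbd := h.hbd.symm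
  hx := by have := h.hx; grind
  hy := by have := h.hy; grind
  hz := by have := h.hz; grind

theorem swap_xy (h : Cyc G x y z u v a b c d) : Cyc G y x z u v a b c d where
  xyzu := h.xyzu.perm (by grind)
  xyzv := h.xyzv.perm (by grind)
  uvab := h.uvab
  uvbc := h.uvbc
  uvcd := h.uvcd
  uvda := h.uvda
  hac := h.hac
  hbd := h.hbd
  hx := h.hy
  hy := h.hx
  hz := h.hz

theorem swap_yz (h : Cyc G x y z u v a b c d) : Cyc G x z y u v a b c d where
  xyzu := h.xyzu.perm (by grind)
  xyzv := h.xyzv.perm (by grind)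
  uvab := h.uvab
  uvbc := h.uvbc
  uvcd := h.uvcd
  uvda := h.uvda
  hac := h.hac
  hbd := h.hbd
  hx := h.hx
  hy := h.hz
  hz := h.hy

end Cyc

namespace Spread

variable {α : Type*} [DecidableEq α] {G : Finset (Finset α)} {x y z u v a b c d : α}

/-- A member that avoids `a, b, z` contains `c, d` and one of `u, v`; one such member is
`{u, v, c, d}`, and the triples `c d u` and `c d v` allow at most one more each. -/
theorem false_of_common_third_point (hG : Spread G) (h₁ : Quad G u v a b) (h₂ : Quad G u v c d)
    (h₃ : Quad G a b c z) (h₄ : Quad G a b d z) : False := by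
  have n₁ := hG.ne h₁
  have n₂ := hG.ne h₂
  have key : ∀ A ∈ G, (a ∉ A ∧ b ∉ A ∧ z ∉ A) → c ∈ A ∧ d ∈ A ∧ (u ∈ A ∨ v ∈ A) := by
    intro A hA av
    have := hG.hit h₁ hA
    have := hG.hit h₃ hA
    have := hG.hit h₄ hA
    grind
  have sub : ∀ u v : α, Quad G u v c d → c ≠ u → d ≠ u → ∀ A ∈ G, ∀ B ∈ G,
      (a ∉ A ∧ b ∉ A ∧ z ∉ A) → (a ∉ B ∧ b ∉ B ∧ z ∉ B) → (u ∈ A ∧ v ∉ A) → (u ∈ B ∧ v ∉ B) →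
      A = B := by
    intro u v h₂ h1 h2 A hA B hB aA aB hA' hB'
    have kA := key A hA aA
    have kB := key B hB aB
    rcases hG.triple_mem_le_two (a := c) (b := d) (c := u) n₂.2.2.2.2.2 h1 h2 hA hB h₂
      ⟨kA.1, kA.2.1, hA'.1⟩ ⟨kB.1, kB.2.1, hB'.1⟩ (by simp) with h | rfl | rfl
    · exact h
    · simp at hA'
    · simp at hB'
  obtain ⟨A, hA, av, p₁, p₂, p₃⟩ := hG.exists_one a b z (fun A => u ∈ A ∧ v ∈ A)
    (fun A => u ∈ A ∧ v ∉ A) (fun A => v ∈ A ∧ u ∉ A) (by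
      intro A hA B hB aA aB hA' hB'
      have kA := key A hA aA
      have kB := key B hB aB
      rw [hG.eq_quad hA hA'.1 hA'.2 kA.1 kA.2.1 n₂.1 n₂.2.1 n₂.2.2.1 n₂.2.2.2.1 n₂.2.2.2.2.1
        n₂.2.2.2.2.2, hG.eq_quad hB hB'.1 hB'.2 kB.1 kB.2.1 n₂.1 n₂.2.1 n₂.2.2.1 n₂.2.2.2.1
        n₂.2.2.2.2.1 n₂.2.2.2.2.2])
    (sub u v h₂ (by grind) (by grind)) (sub v u (h₂.perm (by grind)) (by grind) (by grind))
  have := key A hA av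
  grind

theorem mem_of_avoids_uvd (hG : Spread G) (h : Cyc G x y z u v a b c d) {A : Finset α}
    (hA : A ∈ G) (av : u ∉ A ∧ v ∉ A ∧ d ∉ A) : a ∈ A ∧ c ∈ A ∧ (x ∈ A ∨ y ∈ A ∨ z ∈ A) := by
  have := hG.hit h.uvda hA
  have := hG.hit h.uvcd hA
  have := hG.hit h.xyzu hA
  grind

/-- The case in which `g` is joined to both `x` and `z`: then `d` is joined to two of `u, v, b` in
the link of `{x, z}`, but `{x, z, d, u}` and `{x, z, d, v}` miss the member `{a, c, y, q}`. -/
theorem false_of_common_neighbour (hG : Spread G) (h : Cyc G x y z u v a b c d) {g q : α}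
    (g₂ : Quad G a c d y) (k₁ : Quad G a c x g) (k₂ : Quad G a c z g)
    (k₃ : Quad G a c y q) (hq : q ≠ x ∧ q ≠ z ∧ q ≠ d ∧ q ≠ u ∧ q ≠ v) : False := by
  have := hG.ne h.xyzu
  have := hG.ne h.xyzv
  have := hG.ne h.uvab
  have := hG.ne h.uvbc
  have := hG.ne h.uvcd
  have := hG.ne h.uvda
  have := h.hx
  have := h.hy
  have := h.hz
  have := h.hbd
  have no : ∀ i, (i = u ∨ i = v) → ¬ Quad G x z d i := by
    intro i hi h'
    have := hG.hit_quad h' k₃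
    grind
  rcases hG.two_of_three (x := u) (y := v) (z := b) (u := a) (v := c) (a := x) (b := g) (c := z)
      (d := d) (e := y) (h.uvab.perm (by grind)) (k₁.perm (by grind)) (k₂.perm (by grind)) g₂
      (by grind) (by grind) (by grind) (by grind) with ⟨q₁, q₂⟩ | ⟨q₁, q₂⟩ | ⟨q₁, q₂⟩
  · exact no u (by simp) q₁
  · exact no u (by simp) q₁
  · exact no v (by simp) q₁

/-- The case in which the edge at `x` ends in one of the neighbours `g`, `b` of `z`. -/
theorem false_of_neighbour_eq (hG : Spread G) (h : Cyc G x y z u v a b c d) {g q q' : α}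
    (g₁ : Quad G a c d x) (g₂ : Quad G a c d y) (k₁ : Quad G a c z g) (k₂ : Quad G a c z b)
    (k₃ : Quad G a c x q) (k₄ : Quad G a c y q')
    (hg : g ≠ x ∧ g ≠ y ∧ g ≠ b ∧ g ≠ d ∧ g ≠ u ∧ g ≠ v)
    (hq : q ≠ y ∧ q ≠ z ∧ q ≠ d ∧ q ≠ u ∧ q ≠ v) (hq' : q' ≠ x ∧ q' ≠ z ∧ q' ≠ d ∧ q' ≠ u ∧ q' ≠ v)
    (hqg : q = g ∨ q = b) : False := by
  have := hG.ne h.xyzu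
  have := hG.ne h.xyzv
  have := hG.ne h.uvab
  have := hG.ne h.uvbc
  have := hG.ne h.uvcd
  have := hG.ne h.uvda
  have := hG.ne k₁
  have := hG.ne k₄
  have := h.hx
  have := h.hy
  have := h.hz
  have := h.hbd
  rcases hqg with rfl | rfl
  · exact hG.false_of_common_neighbour h g₂ k₃ k₁ k₄ hq'
  by_cases hg' : q' = g
  · subst hg'
    exact hG.false_of_common_neighbour h.swap_xy g₁ k₄ k₁ k₃ hq
  have hqq : q' ≠ q := by
    rintro rfl
    have := hG.triple_le_two (a := a) (b := c) (c := q') (p := x) (q := y) (r := z)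
      (k₃.perm (by grind)) (k₄.perm (by grind)) (k₂.perm (by grind))
    grind
  have no : ∀ i, (i = u ∨ i = v) → ¬ Quad G g q q' i := by
    intro i hi h'
    have := hG.hit_quad h' g₁
    have := hG.ne g₁
    grind
  rcases hG.two_of_three (x := u) (y := v) (z := d) (u := a) (v := c) (a := g) (b := z) (c := q)
      (d := q') (e := y) (h.uvda.perm (by grind)) k₁ k₂ (k₄.perm (by grind))
      (by grind) (by grind) (by grind) (by grind) with ⟨q₁, q₂⟩ | ⟨q₁, q₂⟩ | ⟨q₁, q₂⟩
  · exact no u (by simp) q₁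
  · exact no u (by simp) q₁
  · exact no v (by simp) q₁

/-- If `d` is joined to `x` and `y` in the link of `{a, c}`, the four members that avoid `u, v, d`
are determined up to the names `g, q, q'`. -/
theorem exists_link_edges (hG : Spread G) (h : Cyc G x y z u v a b c d)
    (g₁ : Quad G a c d x) (g₂ : Quad G a c d y) :
    ∃ g q q', Quad G a c z g ∧ Quad G a c z b ∧ Quad G a c x q ∧ Quad G a c y q' ∧
      (g ≠ x ∧ g ≠ y ∧ g ≠ b ∧ g ≠ d ∧ g ≠ u ∧ g ≠ v) ∧ (q ≠ y ∧ q ≠ d ∧ q ≠ u ∧ q ≠ v) ∧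
      (q' ≠ x ∧ q' ≠ d ∧ q' ≠ u ∧ q' ≠ v) := by
  have n₁ := hG.ne h.xyzu
  have n₂ := hG.ne h.xyzv
  have n₃ := hG.ne h.uvab
  have n₄ := hG.ne h.uvbc
  have n₅ := hG.ne h.uvcd
  have n₆ := hG.ne h.uvda
  have hx := h.hx
  have hy := h.hy
  have hz := h.hz
  have hac := h.hac
  have hbd := h.hbd
  have mem := fun {A : Finset α} (hA : A ∈ G) (av : u ∉ A ∧ v ∉ A ∧ d ∉ A) =>
    hG.mem_of_avoids_uvd h hA av
  have subx : ∀ x, Quad G a c d x → x ≠ a → x ≠ c → ∀ A ∈ G, ∀ B ∈ G, (u ∉ A ∧ v ∉ A ∧ d ∉ A) →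
      (u ∉ B ∧ v ∉ B ∧ d ∉ B) → x ∈ A → x ∈ B → A = B := by
    intro x g h1 h2 A hA B hB aA aB hA' hB'
    rcases hG.triple_mem_le_two (a := a) (b := c) (c := x) hac h1.symm h2.symm hA hB g
      ⟨(mem hA aA).1, (mem hA aA).2.1, hA'⟩ ⟨(mem hB aB).1, (mem hB aB).2.1, hB'⟩ (by simp)
      with h | rfl | rfl
    · exact h
    · simp at aA
    · simp at aB
  have subp : ∀ s t : α, s ≠ a → s ≠ c → t ≠ a → t ≠ c → s ≠ t → ∀ A ∈ G, ∀ B ∈ G,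
      (u ∉ A ∧ v ∉ A ∧ d ∉ A) → (u ∉ B ∧ v ∉ B ∧ d ∉ B) → s ∈ A ∧ t ∈ A → s ∈ B ∧ t ∈ B →
      A = B := by
    intro s t h1 h2 h3 h4 h5 A hA B hB aA aB hA' hB'
    rw [hG.eq_quad hA (mem hA aA).1 (mem hA aA).2.1 hA'.1 hA'.2 hac h1.symm h3.symm h2.symm h4.symm
      h5, hG.eq_quad hB (mem hB aB).1 (mem hB aB).2.1 hB'.1 hB'.2 hac h1.symm h3.symm h2.symm
      h4.symm h5]
  -- of four members avoiding `u, v, d`, one contains none of `x, y, b`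
  obtain ⟨A, hA, av, p₁, p₂, p₃⟩ := hG.exists_one u v d (fun A => x ∈ A) (fun A => y ∈ A)
    (fun A => b ∈ A ∧ z ∈ A) (subx x g₁ (by grind) (by grind)) (subx y g₂ (by grind) (by grind))
    (subp b z (by grind) (by grind) (by grind) (by grind) (by grind))
  have mA := mem hA av
  obtain ⟨g, rfl, kg⟩ := hG.eq_insert hA mA.1 mA.2.1 (c := z) (by grind) hac (by grind) (by grind)
  have ng := hG.ne kg
  have hg : g ≠ x ∧ g ≠ y ∧ g ≠ b ∧ g ≠ d ∧ g ≠ u ∧ g ≠ v := by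
    simp only [Finset.mem_insert, Finset.mem_singleton] at p₁ p₂ p₃ av
    grind
  -- it is the only such member
  obtain ⟨i, hi, ki⟩ : ∃ i, (i = u ∨ i = v ∨ i = b) ∧ Quad G x y g i := by
    rcases hG.two_of_three (x := u) (y := v) (z := b) (u := a) (v := c) (a := x) (b := d) (c := y)
      (d := g) (e := z) (h.uvab.perm (by grind)) g₁ g₂ (kg.perm (by grind)) (by grind) (by grind)
      (by grind) (by grind) with ⟨q₁, q₂⟩ | ⟨q₁, q₂⟩ | ⟨q₁, q₂⟩
    · exact ⟨u, by simp, q₁⟩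
    · exact ⟨u, by simp, q₁⟩
    · exact ⟨v, by simp, q₁⟩
  have only : ∀ A ∈ G, (u ∉ A ∧ v ∉ A ∧ d ∉ A) → x ∉ A → y ∉ A → b ∉ A → z ∈ A ∧ g ∈ A := by
    intro A hA av h1 h2 h3
    have := mem hA av
    have := hG.hit ki hA
    grind
  have subzg := subp z g (by grind) (by grind) (by grind) (by grind) (by grind)
  have subbz := subp b z (by grind) (by grind) (by grind) (by grind) (by grind)
  obtain ⟨A₁, hA₁, av₁, p₁, p₂, p₃⟩ := hG.exists_one u v d (fun A => y ∈ A)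
    (fun A => b ∈ A ∧ z ∈ A) (fun A => z ∈ A ∧ g ∈ A) (subx y g₂ (by grind) (by grind)) subbz subzg
  have m₁ := mem hA₁ av₁
  have o₁ := only A₁ hA₁ av₁
  obtain ⟨q, rfl, kq⟩ := hG.eq_insert hA₁ m₁.1 m₁.2.1 (c := x) (by grind) hac (by grind) (by grind)
  have hq : q ≠ y ∧ q ≠ d ∧ q ≠ u ∧ q ≠ v := by
    simp only [Finset.mem_insert, Finset.mem_singleton] at p₁ av₁
    grind
  obtain ⟨A₂, hA₂, av₂, p₁, p₂, p₃⟩ := hG.exists_one u v d (fun A => x ∈ A)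
    (fun A => b ∈ A ∧ z ∈ A) (fun A => z ∈ A ∧ g ∈ A) (subx x g₁ (by grind) (by grind)) subbz subzg
  have m₂ := mem hA₂ av₂
  have o₂ := only A₂ hA₂ av₂
  obtain ⟨q', rfl, kq'⟩ := hG.eq_insert hA₂ m₂.1 m₂.2.1 (c := y) (by grind) hac (by grind)
    (by grind)
  have hq' : q' ≠ x ∧ q' ≠ d ∧ q' ≠ u ∧ q' ≠ v := by
    simp only [Finset.mem_insert, Finset.mem_singleton] at p₁ av₂
    grind
  obtain ⟨A₃, hA₃, av₃, p₁, p₂, p₃⟩ := hG.exists_one u v d (fun A => x ∈ A) (fun A => y ∈ A)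
    (fun A => z ∈ A ∧ g ∈ A) (subx x g₁ (by grind) (by grind)) (subx y g₂ (by grind) (by grind))
    subzg
  have m₃ := mem hA₃ av₃
  have o₃ := only A₃ hA₃ av₃
  have kb : Quad G a c z b := hG.quad_of_mem hA₃ m₃.1 m₃.2.1 (by grind) (by grind) hac (by grind)
    (by grind) (by grind) (by grind) (by grind)
  exact ⟨g, q, q', kg, kb, kq, kq', hg, hq, hq'⟩

/-- In the link of `{a, c}` the point `d` is not joined to both `x` and `y`. -/
theorem not_link (hG : Spread G) (h : Cyc G x y z u v a b c d)
    (g₁ : Quad G a c d x) (g₂ : Quad G a c d y) : False := by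
  obtain ⟨g, q, q', kg, kb, kq, kq', hg, hq, hq'⟩ := hG.exists_link_edges h g₁ g₂
  have n₁ := hG.ne h.xyzu
  have n₂ := hG.ne h.xyzv
  have n₃ := hG.ne h.uvab
  have n₄ := hG.ne h.uvbc
  have n₅ := hG.ne h.uvcd
  have n₆ := hG.ne h.uvda
  have hx := h.hx
  have hy := h.hy
  have hz := h.hz
  have hac := h.hac
  have hbd := h.hbd
  have hqz : q ≠ z := by
    rintro rfl
    have := hG.triple_le_two (r := x) kg kb (kq.perm (by grind))
    grind
  have hqz' : q' ≠ z := by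
    rintro rfl
    have := hG.triple_le_two (r := y) kg kb (kq'.perm (by grind))
    grind
  by_cases hqg : q = g ∨ q = b
  · exact hG.false_of_neighbour_eq h g₁ g₂ kg kb kq kq' (by grind) (by grind) (by grind) hqg
  by_cases hqg' : q' = g ∨ q' = b
  · exact hG.false_of_neighbour_eq h.swap_xy g₂ g₁ kg kb kq' kq (by grind) (by grind) (by grind)
      hqg'
  have ng := hG.ne kg
  have no : ∀ i, (i = u ∨ i = v ∨ i = d) → ¬ Quad G g b x i := by
    intro i hi h'
    have := hG.hit_quad h' kq'
    grind
  have nq := hG.ne kq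
  rcases hG.two_of_three (x := u) (y := v) (z := d) (u := a) (v := c) (a := g) (b := z) (c := b)
      (d := x) (e := q) (h.uvda.perm (by grind)) kg kb kq (by grind) (by grind) (by grind)
      (by grind) with ⟨q₁, q₂⟩ | ⟨q₁, q₂⟩ | ⟨q₁, q₂⟩
  · exact no u (by simp) q₁
  · exact no u (by simp) q₁
  · exact no v (by simp) q₁

end Spread
end TripleDiversity

/-! ### No such family of `4`-sets exists -/

namespace TripleDiversity
namespace Spread

variable {α : Type*} [DecidableEq α] {G : Finset (Finset α)} {x y z u v a b c d : α}

/-- In the link of `{a, c}` the point `d` is joined to at most one of `x, y, z`. -/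
theorem link_unique (hG : Spread G) (h : Cyc G x y z u v a b c d) {s t : α}
    (hs : s = x ∨ s = y ∨ s = z) (ht : t = x ∨ t = y ∨ t = z) (g₁ : Quad G a c d s)
    (g₂ : Quad G a c d t) : s = t := by
  have hxy := fun g₁ g₂ => hG.not_link h g₁ g₂
  have hxz := fun g₁ g₂ => hG.not_link h.swap_yz g₁ g₂
  have hyz := fun g₁ g₂ => hG.not_link h.swap_xy.swap_yz g₁ g₂
  rcases hs with rfl | rfl | rfl <;> rcases ht with rfl | rfl | rfl <;> first | rfl | grind

/-- At least four members avoid `u, v, b`, all contain `a, c`, and at most one contains `d`. -/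
theorem exists_three_link (hG : Spread G) (h : Cyc G x y z u v a b c d) :
    ∃ A ∈ G, ∃ B ∈ G, ∃ C ∈ G, A ≠ B ∧ A ≠ C ∧ B ≠ C ∧
      (u ∉ A ∧ v ∉ A ∧ b ∉ A ∧ d ∉ A ∧ a ∈ A ∧ c ∈ A) ∧
      (u ∉ B ∧ v ∉ B ∧ b ∉ B ∧ d ∉ B ∧ a ∈ B ∧ c ∈ B) ∧
      (u ∉ C ∧ v ∉ C ∧ b ∉ C ∧ d ∉ C ∧ a ∈ C ∧ c ∈ C) := by
  have n₅ := hG.ne h.uvcd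
  have n₆ := hG.ne h.uvda
  have mem : ∀ A ∈ G, (u ∉ A ∧ v ∉ A ∧ b ∉ A) → a ∈ A ∧ c ∈ A ∧ (x ∈ A ∨ y ∈ A ∨ z ∈ A) :=
    fun A hA av => hG.mem_of_avoids_uvd h.reflect hA av
  have quad : ∀ A ∈ G, (u ∉ A ∧ v ∉ A ∧ b ∉ A) → d ∈ A →
      ∃ t, A = {a, c, d, t} ∧ Quad G a c d t ∧ (t = x ∨ t = y ∨ t = z) := by
    intro A hA av hd
    have m := mem A hA av
    obtain ⟨t, rfl, ht⟩ := hG.eq_insert hA m.1 m.2.1 hd h.hac (by grind) (by grind)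
    have hx := h.hx
    have hy := h.hy
    have hz := h.hz
    have m' := m.2.2
    simp only [Finset.mem_insert, Finset.mem_singleton] at m'
    exact ⟨t, rfl, ht, by grind⟩
  obtain ⟨A, hA, B, hB, C, hC, h1, h2, h3, aA, aB, aC, nA, nB, nC⟩ :=
    hG.exists_three u v b (fun A => d ∈ A) (by
      intro A hA B hB a1 a2 a3 b1 b2 b3 hA' hB'
      obtain ⟨s, rfl, ks, hs⟩ := quad A hA ⟨a1, a2, a3⟩ hA'
      obtain ⟨t, rfl, kt, ht⟩ := quad B hB ⟨b1, b2, b3⟩ hB'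
      rw [hG.link_unique h hs ht ks kt])
  have mA := mem A hA aA
  have mB := mem B hB aB
  have mC := mem C hC aC
  exact ⟨A, hA, B, hB, C, hC, h1, h2, h3, ⟨aA.1, aA.2.1, aA.2.2, nA, mA.1, mA.2.1⟩,
    ⟨aB.1, aB.2.1, aB.2.2, nB, mB.1, mB.2.1⟩, ⟨aC.1, aC.2.1, aC.2.2, nC, mC.1, mC.2.1⟩⟩

/-- Members `{a, c, _, _}` and `{b, d, _, _}` off the cycle meet in their other points. If the link
of `{b, d}` has the edges `p q` and `p r` and a third edge that misses `p`, this forces crossing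
paths `m p q r` and `r p q m` in the links of `{a, c}` and `{b, d}`, with the names of `q` and `r`
possibly exchanged. The case `r = m`, where both are triangles, is included. -/
theorem exists_cross_paths_of_two_edges (hG : Spread G) (h : Cyc G x y z u v a b c d) {p q r : α}
    {B : Finset α} (hB : B ∈ G) (k₁ : Quad G b d p q) (k₂ : Quad G b d p r) (hqr : q ≠ r)
    (hp : p ≠ a ∧ p ≠ c) (hq : q ≠ a ∧ q ≠ c ∧ q ≠ u ∧ q ≠ v)
    (hr : r ≠ a ∧ r ≠ c ∧ r ≠ u ∧ r ≠ v)
    (avB : u ∉ B ∧ v ∉ B ∧ a ∉ B ∧ c ∉ B ∧ b ∈ B ∧ d ∈ B) (hpB : p ∉ B) :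
    ∃ q r m, Quad G a c p q ∧ Quad G a c p m ∧ Quad G a c q r ∧ Quad G b d p q ∧
      Quad G b d p r ∧ Quad G b d q m ∧ q ≠ m ∧ (q ≠ u ∧ q ≠ v) ∧ (r ≠ u ∧ r ≠ v) ∧
      (m ≠ u ∧ m ≠ v) := by
  have nk₁ := hG.ne k₁
  have nk₂ := hG.ne k₂
  obtain ⟨A₁, hA₁, A₂, hA₂, A₃, hA₃, h12, h13, h23, e₁, e₂, e₃⟩ := hG.exists_three_link h
  have hac := h.hac
  have hqr' : ∀ A ∈ G, (u ∉ A ∧ v ∉ A ∧ b ∉ A ∧ d ∉ A ∧ a ∈ A ∧ c ∈ A) → p ∉ A →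
      A = {a, c, q, r} := by
    intro A hA e hp'
    have := hG.hit k₁ hA
    have := hG.hit k₂ hA
    exact hG.eq_quad hA e.2.2.2.2.1 e.2.2.2.2.2 (by grind) (by grind) hac (by grind) (by grind)
      (by grind) (by grind) hqr
  have main : ∀ A ∈ G, ∀ A' ∈ G, ∀ A'' ∈ G,
      (u ∉ A ∧ v ∉ A ∧ b ∉ A ∧ d ∉ A ∧ a ∈ A ∧ c ∈ A) →
      (u ∉ A' ∧ v ∉ A' ∧ b ∉ A' ∧ d ∉ A' ∧ a ∈ A' ∧ c ∈ A') →
      (u ∉ A'' ∧ v ∉ A'' ∧ b ∉ A'' ∧ d ∉ A'' ∧ a ∈ A'' ∧ c ∈ A'') → A' ≠ A'' →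
      p ∉ A → p ∈ A' → p ∈ A'' →
      ∃ q r m, Quad G a c p q ∧ Quad G a c p m ∧ Quad G a c q r ∧ Quad G b d p q ∧
      Quad G b d p r ∧ Quad G b d q m ∧ q ≠ m ∧ (q ≠ u ∧ q ≠ v) ∧ (r ≠ u ∧ r ≠ v) ∧
      (m ≠ u ∧ m ≠ v) := by
    intro A hA A' hA' A'' hA'' e e' e'' hne hpA hpA' hpA''
    obtain rfl := hqr' A hA e hpA
    obtain ⟨m, rfl, km⟩ := hG.eq_insert hA' e'.2.2.2.2.1 e'.2.2.2.2.2 hpA' hac hp.1.symm hp.2.symm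
    obtain ⟨n, rfl, kn⟩ := hG.eq_insert hA'' e''.2.2.2.2.1 e''.2.2.2.2.2 hpA'' hac hp.1.symm
      hp.2.symm
    have hmn : m ≠ n := by rintro rfl; exact hne rfl
    have iB := hG.hit hA hB
    have iB' := hG.hit km hB
    have iB'' := hG.hit kn hB
    have hmB : m ∈ B := by grind
    have hnB : n ∈ B := by grind
    simp only [Finset.mem_insert, Finset.mem_singleton, not_or] at e' e''
    have nm := hG.ne km
    have nn := hG.ne kn
    have kB : Quad G b d m n := hG.quad_of_mem hB avB.2.2.2.2.1 avB.2.2.2.2.2 hmB hnB (by grind)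
      (by grind) (by grind) (by grind) (by grind) hmn
    have hB' := hG.eq_quad hB avB.2.2.2.2.1 avB.2.2.2.2.2 hmB hnB (by grind)
      (by grind) (by grind) (by grind) (by grind) hmn
    have cases4 : (m = q ∨ m = r) ∨ (n = q ∨ n = r) := by
      subst hB'
      simp only [Finset.mem_insert, Finset.mem_singleton] at iB avB
      grind
    have kA : Quad G a c q r := hA
    rcases cases4 with (rfl | rfl) | (rfl | rfl)
    · exact ⟨m, r, n, km, kn, kA, k₁, k₂, kB, hmn, by grind, by grind, by grind⟩
    · exact ⟨m, q, n, km, kn, kA.perm (by grind), k₂, k₁, kB, hmn, by grind, by grind, by grind⟩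
    · exact ⟨n, r, m, kn, km, kA, k₁, k₂, kB.perm (by grind), hmn.symm, by grind, by grind,
        by grind⟩
    · exact ⟨n, q, m, kn, km, kA.perm (by grind), k₂, k₁, kB.perm (by grind), hmn.symm, by grind,
        by grind, by grind⟩
  have hall : ¬ (p ∈ A₁ ∧ p ∈ A₂ ∧ p ∈ A₃) := by
    rintro ⟨h1, h2, h3⟩
    rcases hG.triple_mem_le_two (a := a) (b := c) (c := p) hac hp.1.symm hp.2.symm hA₁ hA₂ hA₃
      (by grind) (by grind) (by grind) with h | h | h
    · exact h12 h
    · exact h13 h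
    · exact h23 h
  by_cases p₁ : p ∈ A₁
  · by_cases p₂ : p ∈ A₂
    · exact main A₃ hA₃ A₁ hA₁ A₂ hA₂ e₃ e₁ e₂ h12 (fun p₃ => hall ⟨p₁, p₂, p₃⟩) p₁ p₂
    · by_cases p₃ : p ∈ A₃
      · exact main A₂ hA₂ A₁ hA₁ A₃ hA₃ e₂ e₁ e₃ h13 p₂ p₁ p₃
      · exact absurd ((hqr' A₂ hA₂ e₂ p₂).trans (hqr' A₃ hA₃ e₃ p₃).symm) h23
  · by_cases p₂ : p ∈ A₂
    · by_cases p₃ : p ∈ A₃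
      · exact main A₁ hA₁ A₂ hA₂ A₃ hA₃ e₁ e₂ e₃ h23 p₁ p₂ p₃
      · exact absurd ((hqr' A₁ hA₁ e₁ p₁).trans (hqr' A₃ hA₃ e₃ p₃).symm) h13
    · exact absurd ((hqr' A₁ hA₁ e₁ p₁).trans (hqr' A₂ hA₂ e₂ p₂).symm) h12

/-- Off the cycle, the links of `{a, c}` and of `{b, d}` contain paths `m p q r` and `r p q m` with
the same middle edge. -/
theorem exists_cross_paths (hG : Spread G) (h : Cyc G x y z u v a b c d) :
    ∃ p q r m, Quad G a c p q ∧ Quad G a c p m ∧ Quad G a c q r ∧ Quad G b d p q ∧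
      Quad G b d p r ∧ Quad G b d q m ∧ q ≠ m ∧ (p ≠ u ∧ p ≠ v) ∧ (q ≠ u ∧ q ≠ v) ∧
      (r ≠ u ∧ r ≠ v) ∧ (m ≠ u ∧ m ≠ v) := by
  obtain ⟨A, hA, -, -, -, -, -, -, -, eA, -, -⟩ := hG.exists_three_link h
  obtain ⟨B₁, hB₁, B₂, hB₂, B₃, hB₃, h12, h13, h23, e₁, e₂, e₃⟩ := hG.exists_three_link h.rotate
  have hbd := h.hbd
  obtain ⟨s, t, rfl⟩ := hG.eq_insert_pair hA eA.2.2.2.2.1 eA.2.2.2.2.2 h.hac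
  have nA := hG.ne hA
  simp only [Finset.mem_insert, Finset.mem_singleton, not_or] at eA
  -- two of three members containing `b, d` meet a member containing `a, c` in the same point
  have main : ∀ B ∈ G, ∀ B' ∈ G, ∀ B'' ∈ G, B ≠ B' → B ≠ B'' → B' ≠ B'' →
      (u ∉ B ∧ v ∉ B ∧ c ∉ B ∧ a ∉ B ∧ b ∈ B ∧ d ∈ B) →
      (u ∉ B' ∧ v ∉ B' ∧ c ∉ B' ∧ a ∉ B' ∧ b ∈ B' ∧ d ∈ B') →
      (u ∉ B'' ∧ v ∉ B'' ∧ c ∉ B'' ∧ a ∉ B'' ∧ b ∈ B'' ∧ d ∈ B'') →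
      ∀ p, p = s ∨ p = t → p ∈ B → p ∈ B' →
      ∃ p q r m, Quad G a c p q ∧ Quad G a c p m ∧ Quad G a c q r ∧ Quad G b d p q ∧
      Quad G b d p r ∧ Quad G b d q m ∧ q ≠ m ∧ (p ≠ u ∧ p ≠ v) ∧ (q ≠ u ∧ q ≠ v) ∧
      (r ≠ u ∧ r ≠ v) ∧ (m ≠ u ∧ m ≠ v) := by
    intro B hB B' hB' B'' hB'' n1 n2 n3 e e' e'' p hp hpB hpB'
    have hpb : b ≠ p := by grind
    have hpd : d ≠ p := by grind
    have hpB'' : p ∉ B'' := by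
      intro hpB''
      rcases hG.triple_mem_le_two (a := b) (b := d) (c := p) hbd hpb hpd hB hB' hB''
        (by grind) (by grind) (by grind) with h | h | h
      · exact n1 h
      · exact n2 h
      · exact n3 h
    obtain ⟨q, rfl, kq⟩ := hG.eq_insert hB e.2.2.2.2.1 e.2.2.2.2.2 hpB hbd hpb hpd
    obtain ⟨r, rfl, kr⟩ := hG.eq_insert hB' e'.2.2.2.2.1 e'.2.2.2.2.2 hpB' hbd hpb hpd
    have hqr : q ≠ r := by rintro rfl; exact n1 rfl
    simp only [Finset.mem_insert, Finset.mem_singleton, not_or] at e e'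
    obtain ⟨q, r, m, h1, h2, h3, h4, h5, h6, h7, h8, h9, h10⟩ :=
      hG.exists_cross_paths_of_two_edges h hB'' kq kr hqr (by grind) (by grind) (by grind) (by grind)
        hpB''
    exact ⟨p, q, r, m, h1, h2, h3, h4, h5, h6, h7, by grind, h8, h9, h10⟩
  have hit : ∀ B ∈ G, (u ∉ B ∧ v ∉ B ∧ c ∉ B ∧ a ∉ B ∧ b ∈ B ∧ d ∈ B) → s ∈ B ∨ t ∈ B := by
    intro B hB e
    have := hG.hit hA hB
    grind
  have m12 := main B₁ hB₁ B₂ hB₂ B₃ hB₃ h12 h13 h23 e₁ e₂ e₃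
  have m13 := main B₁ hB₁ B₃ hB₃ B₂ hB₂ h13 h12 h23.symm e₁ e₃ e₂
  have m23 := main B₂ hB₂ B₃ hB₃ B₁ hB₁ h23 h12.symm h13.symm e₂ e₃ e₁
  rcases hit B₁ hB₁ e₁ with g₁ | g₁ <;> rcases hit B₂ hB₂ e₂ with g₂ | g₂ <;>
    rcases hit B₃ hB₃ e₃ with g₃ | g₃
  · exact m12 s (by simp) g₁ g₂
  · exact m12 s (by simp) g₁ g₂
  · exact m13 s (by simp) g₁ g₃
  · exact m23 t (by simp) g₂ g₃
  · exact m23 s (by simp) g₂ g₃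
  · exact m13 t (by simp) g₁ g₃
  · exact m12 t (by simp) g₁ g₂
  · exact m12 t (by simp) g₁ g₂

/-- A fourth member that avoids `u, v, d`, besides `{a, c}` with the three edges of the path, has to
contain `b`. -/
theorem exists_pendant_off_middle (hG : Spread G) (h : Cyc G x y z u v a b c d) {p q r m : α}
    (k₁ : Quad G a c p q) (k₂ : Quad G a c p m) (k₃ : Quad G a c q r) (l₁ : Quad G b d p q)
    (l₂ : Quad G b d p r) (l₃ : Quad G b d q m) (hqm : q ≠ m) :
    ∃ s, (s = x ∨ s = y ∨ s = z) ∧ Quad G a c b s ∧ s ≠ p ∧ s ≠ q := by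
  have hac := h.hac
  have hx := h.hx
  have hy := h.hy
  have hz := h.hz
  have n₁ := hG.ne k₁
  have n₂ := hG.ne k₂
  have n₃ := hG.ne k₃
  have m₁ := hG.ne l₁
  have m₂ := hG.ne l₂
  have m₃ := hG.ne l₃
  have n₄ := hG.ne h.uvab
  have n₅ := hG.ne h.uvbc
  have mem := fun {A : Finset α} (hA : A ∈ G) (av : u ∉ A ∧ v ∉ A ∧ d ∉ A) =>
    hG.mem_of_avoids_uvd h hA av
  have sub : ∀ s t : α, Quad G a c s t → ∀ A ∈ G, ∀ B ∈ G,
      (u ∉ A ∧ v ∉ A ∧ d ∉ A) → (u ∉ B ∧ v ∉ B ∧ d ∉ B) → s ∈ A ∧ t ∈ A → s ∈ B ∧ t ∈ B →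
      A = B := by
    intro s t k A hA B hB aA aB hA' hB'
    have nk := hG.ne k
    rw [hG.eq_quad hA (mem hA aA).1 (mem hA aA).2.1 hA'.1 hA'.2 hac nk.2.1 nk.2.2.1 nk.2.2.2.1
      nk.2.2.2.2.1 nk.2.2.2.2.2, hG.eq_quad hB (mem hB aB).1 (mem hB aB).2.1 hB'.1 hB'.2 hac nk.2.1
      nk.2.2.1 nk.2.2.2.1 nk.2.2.2.2.1 nk.2.2.2.2.2]
  obtain ⟨A, hA, av, p₁, p₂, p₃⟩ := hG.exists_one u v d (fun A => p ∈ A ∧ q ∈ A)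
    (fun A => p ∈ A ∧ m ∈ A) (fun A => q ∈ A ∧ r ∈ A) (sub p q k₁) (sub p m k₂) (sub q r k₃)
  have mA := mem hA av
  have hb : b ∈ A := by
    have := hG.hit l₁ hA
    have := hG.hit l₂ hA
    have := hG.hit l₃ hA
    grind
  obtain ⟨s, rfl, ks⟩ := hG.eq_insert hA mA.1 mA.2.1 hb hac (by grind) (by grind)
  have mA' := mA.2.2
  simp only [Finset.mem_insert, Finset.mem_singleton] at mA'
  refine ⟨s, by grind, ks, ?_, ?_⟩
  · rintro rfl
    have := hG.triple_le_two (r := b) k₁ k₂ (ks.perm (by grind))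
    grind
  · rintro rfl
    have := hG.triple_le_two (a := a) (b := c) (c := s) (p := p) (r := b) (k₁.perm (by grind)) k₃
      (ks.perm (by grind))
    grind

/-- In the link of `{a, c}` the point `b` is joined to one of `x, y, z` off the path `m p q r`. -/
theorem exists_pendant (hG : Spread G) (h : Cyc G x y z u v a b c d) {p q r m : α}
    (k₁ : Quad G a c p q) (k₂ : Quad G a c p m) (k₃ : Quad G a c q r) (l₁ : Quad G b d p q)
    (l₂ : Quad G b d p r) (l₃ : Quad G b d q m) (hqm : q ≠ m) (hp : p ≠ u ∧ p ≠ v)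
    (hq : q ≠ u ∧ q ≠ v) :
    ∃ s, (s = x ∨ s = y ∨ s = z) ∧ Quad G a c b s ∧ s ≠ p ∧ s ≠ q ∧ s ≠ r ∧ s ≠ m := by
  obtain ⟨s, hs, ks, hsp, hsq⟩ := hG.exists_pendant_off_middle h k₁ k₂ k₃ l₁ l₂ l₃ hqm
  obtain ⟨t, ht, kt, htp, htq⟩ := hG.exists_pendant_off_middle h.reflect k₁ k₂ k₃
    (l₁.perm (by grind)) (l₂.perm (by grind)) (l₃.perm (by grind)) hqm
  have hac := h.hac
  have hbd := h.hbd
  have hx := h.hx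
  have hy := h.hy
  have hz := h.hz
  have n₁ := hG.ne k₁
  have n₂ := hG.ne k₂
  have n₃ := hG.ne k₃
  have m₁ := hG.ne l₁
  have m₂ := hG.ne l₂
  have m₃ := hG.ne l₃
  have nt := hG.ne kt
  have ns := hG.ne ks
  have n₄ := hG.ne h.uvab
  have n₅ := hG.ne h.uvbc
  have n₈ := hG.ne h.uvcd
  have n₆ := hG.ne h.xyzu
  have n₇ := hG.ne h.xyzv
  have no : ∀ i, (i = u ∨ i = v) → ¬ Quad G b q p i := by
    intro i hi h'
    have := hG.hit_quad h' kt
    grind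
  have no' : ∀ i, (i = u ∨ i = v) → ¬ Quad G b p q i :=
    fun i hi h' => no i hi (h'.perm (by grind))
  have hrm : r = m → s ≠ r := by
    rintro rfl rfl
    have := hG.triple_le_two (a := a) (b := c) (c := s) (p := p) (q := q) (r := b)
      (k₂.perm (by grind)) (k₃.perm (by grind)) (ks.perm (by grind))
    grind
  refine ⟨s, hs, ks, hsp, hsq, ?_, ?_⟩
  · rintro rfl
    rcases hG.two_of_three (x := u) (y := v) (z := d) (u := a) (v := c) (a := b) (b := s) (c := q)
      (d := p) (e := m) (h.uvda.perm (by grind)) (ks.perm (by grind)) (k₃.perm (by grind)) k₂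
      (by grind) (by grind) (by grind) (by grind) with ⟨q₁, q₂⟩ | ⟨q₁, q₂⟩ | ⟨q₁, q₂⟩
    · exact no u (by simp) q₁
    · exact no u (by simp) q₁
    · exact no v (by simp) q₁
  · rintro rfl
    rcases hG.two_of_three (x := u) (y := v) (z := d) (u := a) (v := c) (a := b) (b := s) (c := p)
      (d := q) (e := r) (h.uvda.perm (by grind)) (ks.perm (by grind)) (k₂.perm (by grind)) k₃
      (by grind) (by grind) (by grind) (by grind) with ⟨q₁, q₂⟩ | ⟨q₁, q₂⟩ | ⟨q₁, q₂⟩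
    · exact no' u (by simp) q₁
    · exact no' u (by simp) q₁
    · exact no' v (by simp) q₁

/-- `exists_pendant` for the cycle and for its rotation gives points `s` and `t` among `x, y, z`
with `{a, c, b, s}` and `{b, d, c, t}` in `G`, and off `p, q, r`. Since `{x, y, z, u}` meets the
members on the three edges among `p, q, r`, two of `x, y, z` are among `p, q, r`, so `s = t`. This
contradicts `false_of_common_third_point`. -/
theorem not_cyc (hG : Spread G) : ¬ Cyc G x y z u v a b c d := by
  intro h
  obtain ⟨p, q, r, m, k₁, k₂, k₃, l₁, l₂, l₃, hqm, hp, hq, hr, hm⟩ := hG.exists_cross_paths h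
  have n₁ := hG.ne k₁
  have n₂ := hG.ne k₃
  have n₃ := hG.ne l₂
  have n₆ := hG.ne h.xyzu
  have n₇ := hG.ne h.xyzv
  have n₄ := hG.ne h.uvab
  have n₅ := hG.ne h.uvcd
  have hrq : r ≠ q := by grind
  obtain ⟨s, hs, ks, hs'⟩ := hG.exists_pendant h k₁ k₂ k₃ l₁ l₂ l₃ hqm hp hq
  obtain ⟨t, ht, kt, ht'⟩ := hG.exists_pendant h.rotate (r := m) (m := r) l₁ l₂ l₃
    (k₁.perm (by grind)) (k₂.perm (by grind)) (k₃.perm (by grind)) hrq.symm hp hq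
  have hx := h.hx
  have hy := h.hy
  have hz := h.hz
  -- two of `x, y, z` are among `p, q, r`
  have hst : s = t := by
    have i₁ := hG.hit_quad h.xyzu k₁
    have i₂ := hG.hit_quad h.xyzu k₃
    have i₃ := hG.hit_quad h.xyzu l₂
    have j₁ : p = x ∨ p = y ∨ p = z ∨ q = x ∨ q = y ∨ q = z := by grind
    have j₂ : q = x ∨ q = y ∨ q = z ∨ r = x ∨ r = y ∨ r = z := by grind
    have j₃ : p = x ∨ p = y ∨ p = z ∨ r = x ∨ r = y ∨ r = z := by grind
    clear i₁ i₂ i₃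
    grind
  subst hst
  exact hG.false_of_common_third_point (c := a) (d := d) (z := s) h.uvbc (h.uvda.perm (by grind))
    (ks.perm (by grind)) (kt.perm (by grind))

end Spread

/-- In an intersecting family of `4`-sets, some three points are avoided by at most three of
its members. -/
theorem not_spread {α : Type*} [DecidableEq α] [Nonempty α] (G : Finset (Finset α)) :
    ¬ Spread G := by
  intro hG
  obtain ⟨x, y, z, u, v, a, b, c, d, h⟩ := hG.exists_cyc
  exact hG.not_cyc h

end TripleDiversity

/-! ### Maximal families, transversals and branching -/

namespace TripleDiversity

variable {n k : ℕ}

theorem diversity_le_card_avoiding {l : ℕ} (F : Finset (Finset (Fin n))) {S : Finset (Fin n)}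
    (hS : S.card = l) : diversity l F ≤ (avoiding F S).card :=
  Nat.sInf_le ⟨S, hS, rfl⟩

theorem diversity_mono {l : ℕ} (hl : l ≤ n) {F F' : Finset (Finset (Fin n))} (h : F ⊆ F') :
    diversity l F ≤ diversity l F' := by
  obtain ⟨S₀, -, hS₀⟩ := Finset.exists_subset_card_eq (s := (Finset.univ : Finset (Fin n))) (n := l)
    (by simpa using hl)
  obtain ⟨S, hS, hSd⟩ := Nat.sInf_mem
    (s := (fun S : Finset (Fin n) => (avoiding F' S).card) '' {S | S.card = l})
    ⟨_, S₀, hS₀, rfl⟩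
  refine (diversity_le_card_avoiding F hS).trans ?_
  rw [diversity, ← hSd]
  exact Finset.card_le_card (Finset.filter_subset_filter _ h)

/-- `T` is a transversal of `F`: it meets every member. -/
def IsTransversal (F : Finset (Finset (Fin n))) (T : Finset (Fin n)) : Prop :=
  ∀ A ∈ F, ¬ Disjoint A T

/-- A uniform intersecting family extends to one that contains every `k`-set meeting all of its
members. -/
theorem exists_maximal_intersecting (hk : 1 ≤ k) (F : Finset (Finset (Fin n)))
    (hunif : F ⊆ Finset.powersetCard k Finset.univ)
    (hint : (F : Set (Finset (Fin n))).Intersecting) :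
    ∃ F' : Finset (Finset (Fin n)), F ⊆ F' ∧ F' ⊆ Finset.powersetCard k Finset.univ ∧
      (F' : Set (Finset (Fin n))).Intersecting ∧
      ∀ A : Finset (Fin n), A.card = k → IsTransversal F' A → A ∈ F' := by
  classical
  obtain ⟨F', hF', hmax⟩ := Finset.exists_max_image
    (Finset.univ.filter fun X : Finset (Finset (Fin n)) => F ⊆ X ∧
      X ⊆ Finset.powersetCard k Finset.univ ∧ (X : Set (Finset (Fin n))).Intersecting)
    Finset.card ⟨F, by simp [hunif, hint]⟩
  simp only [Finset.mem_filter, Finset.mem_univ, true_and] at hF' hmax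
  refine ⟨F', hF'.1, hF'.2.1, hF'.2.2, fun A hA hT => ?_⟩
  by_contra hAF
  have := hmax (insert A F') ⟨hF'.1.trans (Finset.subset_insert _ _), ?_, ?_⟩
  · rw [Finset.card_insert_of_notMem hAF] at this
    omega
  · intro B hB
    rcases Finset.mem_insert.1 hB with rfl | hB
    · simp [hA]
    · exact hF'.2.1 hB
  · have hA0 : A ≠ ⊥ := by
      rintro rfl
      simp at hA
      omega
    rw [Finset.coe_insert]
    exact hF'.2.2.insert hA0 (fun B hB h => hT B hB h.symm)

/-- The number of members of a uniform family that contain `X` and avoid the triple `S`. -/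
theorem card_supersets_le {F : Finset (Finset (Fin n))}
    (hunif : F ⊆ Finset.powersetCard k Finset.univ) {S X : Finset (Fin n)} (hS : S.card = 3)
    (hXS : Disjoint X S) :
    ((avoiding F S).filter fun A => X ⊆ A).card ≤ (n - 3 - X.card).choose (k - X.card) := by
  have hcard : (Finset.univ \ (X ∪ S)).card = n - 3 - X.card := by
    rw [Finset.card_sdiff_of_subset (Finset.subset_univ _), Finset.card_univ, Fintype.card_fin,
      Finset.card_union_of_disjoint hXS, hS]
    omega
  rw [← hcard, ← Finset.card_powersetCard]
  refine Finset.card_le_card_of_injOn (fun A => A \ X) ?_ ?_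
  · intro A hA
    simp only [avoiding, Finset.coe_filter, Finset.mem_filter, Set.mem_ofPred_eq] at hA
    obtain ⟨⟨hAF, hAS⟩, hXA⟩ := hA
    have hAk := (Finset.mem_powersetCard.1 (hunif hAF)).2
    simp only [Finset.mem_coe, Finset.mem_powersetCard]
    refine ⟨fun t ht => ?_, by rw [Finset.card_sdiff_of_subset hXA, hAk]⟩
    rw [Finset.mem_sdiff] at ht
    simp only [Finset.mem_sdiff, Finset.mem_univ, true_and, Finset.mem_union, not_or]
    exact ⟨ht.2, Finset.disjoint_left.1 hAS ht.1⟩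
  · intro A hA B hB hAB
    simp only [Finset.coe_filter, Set.mem_ofPred_eq] at hA hB
    have hAB' : A \ X = B \ X := hAB
    rw [← Finset.sdiff_union_of_subset hA.2, ← Finset.sdiff_union_of_subset hB.2, hAB']

theorem card_supersets_eq_zero {F : Finset (Finset (Fin n))}
    (hunif : F ⊆ Finset.powersetCard k Finset.univ) {S X : Finset (Fin n)} (hX : k < X.card) :
    ((avoiding F S).filter fun A => X ⊆ A).card = 0 := by
  rw [Finset.card_eq_zero, Finset.filter_eq_empty_iff]
  intro A hA hXA
  have hAk := (Finset.mem_powersetCard.1 (hunif (Finset.mem_filter.1 hA).1)).2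
  have := Finset.card_le_card hXA
  omega

/-- Branching: suppose that every set `X` of fewer than `s` points that avoids `S` and lies in a
member of `𝒜` is avoided by a set that meets all members of `𝒜` and has at most `e |X|` points off
`S`. Building up the members of `𝒜` point by point shows that `𝒜` has at most `e 0 * ⋯ * e (s - 1)`
times as many members as contain a given `s`-set. -/
theorem card_le_prod_of_branching {𝒜 : Finset (Finset (Fin n))} {S : Finset (Fin n)} {s W : ℕ}
    {e : ℕ → ℕ} (hS : ∀ A ∈ 𝒜, Disjoint A S)
    (hW : ∀ X : Finset (Fin n), X.card = s → Disjoint X S → (𝒜.filter fun A => X ⊆ A).card ≤ W)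
    (he : ∀ X : Finset (Fin n), X.card < s → Disjoint X S → (∃ A ∈ 𝒜, X ⊆ A) →
      ∃ E : Finset (Fin n), IsTransversal 𝒜 E ∧ Disjoint E X ∧ (E \ S).card ≤ e X.card) :
    𝒜.card ≤ (∏ i ∈ Finset.range s, e i) * W := by
  have key : ∀ j, ∀ X : Finset (Fin n), X.card + j = s → Disjoint X S →
      (𝒜.filter fun A => X ⊆ A).card ≤ (∏ i ∈ Finset.Ico X.card s, e i) * W := by
    intro j
    induction j with
    | zero =>
      intro X hX hXS
      have hX' : X.card = s := by omega
      rw [hX']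
      simpa using hW X hX' hXS
    | succ j ih =>
      intro X hX hXS
      by_cases hne : ∃ A ∈ 𝒜, X ⊆ A
      swap
      · have : (𝒜.filter fun A => X ⊆ A) = ∅ := by
          rw [Finset.filter_eq_empty_iff]
          exact fun A hA hXA => hne ⟨A, hA, hXA⟩
        simp [this]
      obtain ⟨E, hE, hEX, hEe⟩ := he X (by omega) hXS hne
      have hsub : (𝒜.filter fun A => X ⊆ A) ⊆
          (E \ S).biUnion fun x => 𝒜.filter fun A => insert x X ⊆ A := by
        intro A hA
        rw [Finset.mem_filter] at hA
        obtain ⟨x, hxA, hxE⟩ := Finset.not_disjoint_iff.1 (hE A hA.1)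
        rw [Finset.mem_biUnion]
        refine ⟨x, Finset.mem_sdiff.2 ⟨hxE, Finset.disjoint_left.1 (hS A hA.1) hxA⟩, ?_⟩
        exact Finset.mem_filter.2 ⟨hA.1, Finset.insert_subset hxA hA.2⟩
      rw [Finset.prod_eq_prod_Ico_succ_bot (show X.card < s by omega) e, mul_assoc]
      calc (𝒜.filter fun A => X ⊆ A).card
          ≤ ∑ x ∈ E \ S, (𝒜.filter fun A => insert x X ⊆ A).card :=
            (Finset.card_le_card hsub).trans Finset.card_biUnion_le
        _ ≤ ∑ _x ∈ E \ S, (∏ i ∈ Finset.Ico (X.card + 1) s, e i) * W := by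
            refine Finset.sum_le_sum fun x hx => ?_
            rw [Finset.mem_sdiff] at hx
            have hxX : x ∉ X := Finset.disjoint_left.1 hEX hx.1
            have hc : (insert x X).card = X.card + 1 := Finset.card_insert_of_notMem hxX
            rw [← hc]
            exact ih _ (by omega) (Finset.disjoint_insert_left.2 ⟨hx.2, hXS⟩)
        _ ≤ e X.card * ((∏ i ∈ Finset.Ico (X.card + 1) s, e i) * W) := by
            rw [Finset.sum_const, smul_eq_mul]
            exact Nat.mul_le_mul_right _ hEe
  have h := key s (∅ : Finset (Fin n)) (by simp) (Finset.disjoint_empty_left S)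
  rwa [Finset.filter_true_of_mem (fun A _ => Finset.empty_subset A), Finset.card_empty,
    ← Finset.range_eq_Ico] at h

/-- Two disjoint transversals of size at most `k` of a maximal family extend to disjoint `k`-sets,
of which the first is a member that misses the second. -/
theorem not_disjoint_of_isTransversal {F : Finset (Finset (Fin n))}
    (hmax : ∀ A : Finset (Fin n), A.card = k → IsTransversal F A → A ∈ F)
    {T T' : Finset (Fin n)} (hT : IsTransversal F T) (hT' : IsTransversal F T')
    (hTk : T.card ≤ k) (hn : k + T'.card ≤ n) : ¬ Disjoint T T' := by
  intro hd
  obtain ⟨A, hTA, hA, hAk⟩ := Finset.exists_subsuperset_card_eq (s := T) (t := T'ᶜ) (n := k)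
    (by rw [Finset.subset_compl_iff_disjoint_right]; exact hd) hTk
    (by rw [Finset.card_compl, Fintype.card_fin]; omega)
  refine hT' A (hmax A hAk fun B hB h => hT B hB (h.mono_right hTA)) ?_
  exact Finset.subset_compl_iff_disjoint_right.1 hA

theorem exists_superset_card_three (hn : 3 ≤ n) {X : Finset (Fin n)} (hX : X.card ≤ 3) :
    ∃ S, X ⊆ S ∧ S.card = 3 := by
  obtain ⟨S, h1, -, h2⟩ := Finset.exists_subsuperset_card_eq (Finset.subset_univ X) hX
    (by simpa using hn)
  exact ⟨S, h1, h2⟩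

/-- Each step down the diagonal of Pascal's triangle costs a factor of at least `71 * k`. -/
theorem mul_choose_le {i : ℕ} (hn : 71 * k ^ 2 ≤ n) (hi : 1 ≤ i) (hik : i < k) :
    71 * k * (n - 3 - (i + 1)).choose (k - (i + 1)) ≤ (n - 3 - i).choose (k - i) := by
  obtain ⟨t, rfl⟩ : ∃ t, k = i + 1 + t := ⟨k - (i + 1), by omega⟩
  set k := i + 1 + t with hk
  have h1 : 71 * k * (t + 1) + (i + 3) ≤ n := by nlinarith
  obtain ⟨N, hN⟩ : ∃ N, n - 3 - i = N + 1 := ⟨n - 3 - i - 1, by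
    have : 1 ≤ 71 * k * (t + 1) := by nlinarith
    omega⟩
  have h2 : n - 3 - (i + 1) = N := by omega
  have h3 : k - (i + 1) = t := by omega
  have h4 : k - i = t + 1 := by omega
  rw [hN, h2, h3, h4]
  have h5 := Nat.add_one_mul_choose_eq N t
  refine Nat.le_of_mul_le_mul_right ?_ (Nat.succ_pos t)
  rw [Nat.succ_eq_add_one, ← h5]
  have h6 : 71 * k * (t + 1) ≤ N + 1 := by omega
  calc 71 * k * N.choose t * (t + 1) = 71 * k * (t + 1) * N.choose t := by ring
    _ ≤ (N + 1) * N.choose t := Nat.mul_le_mul_right _ h6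

theorem pow_mul_choose_le (hn : 71 * k ^ 2 ≤ n) (t : ℕ) (ht : 4 + t ≤ k) :
    (71 * k) ^ t * (n - 3 - (4 + t)).choose (k - (4 + t)) ≤ (n - 7).choose (k - 4) := by
  induction t with
  | zero => simp [Nat.sub_sub]
  | succ t ih =>
    refine le_trans ?_ (ih (by omega))
    rw [pow_succ, mul_assoc]
    exact Nat.mul_le_mul_left _ (mul_choose_le (i := 4 + t) hn (by omega) (by omega))

theorem pow_four_le (t : ℕ) (ht : 2 ≤ t) : (4 + t) ^ 4 ≤ 3 * 71 ^ t := by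
  induction t, ht using Nat.le_induction with
  | base => norm_num
  | succ t ht ih =>
    rw [pow_succ 71 t]
    have : (4 + (t + 1)) ^ 4 ≤ 71 * (4 + t) ^ 4 := by
      have h : (4 + (t + 1)) ^ 4 ≤ (2 * (4 + t)) ^ 4 := Nat.pow_le_pow_left (by omega) 4
      rw [mul_pow] at h
      omega
    omega

end TripleDiversity

/-! ### The bound, by the size of the transversals needed -/

namespace TripleDiversity

variable {n k : ℕ}

theorem exists_mem_disjoint_of_not_isTransversal {F : Finset (Finset (Fin n))} {X : Finset (Fin n)}
    (h : ¬ IsTransversal F X) : ∃ A ∈ F, Disjoint A X := by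
  simpa [IsTransversal] using h

theorem card_sdiff_add_one_le {T S : Finset (Fin n)} (h : ¬ Disjoint T S) :
    (T \ S).card + 1 ≤ T.card := by
  obtain ⟨x, hxT, hxS⟩ := Finset.not_disjoint_iff.1 h
  refine Finset.card_lt_card ((Finset.ssubset_iff_of_subset Finset.sdiff_subset).2 ⟨x, hxT, ?_⟩)
  simp [hxS]

/-- Branching inside an intersecting family: the first four steps use the transversals supplied by
`hT`. Afterwards a partial set `X` is no transversal, and a member that misses it, with its `k`
points, serves for the next step. -/
theorem card_le_of_isTransversal {F 𝒜 : Finset (Finset (Fin n))} {S : Finset (Fin n)} {t W : ℕ}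
    {f : ℕ → ℕ} (hunif : F ⊆ Finset.powersetCard k Finset.univ)
    (hint : (F : Set (Finset (Fin n))).Intersecting) (h𝒜 : 𝒜 ⊆ avoiding F S)
    (hW : ∀ X : Finset (Fin n), X.card = 4 + t → Disjoint X S →
      ((avoiding F S).filter fun A => X ⊆ A).card ≤ W)
    (hX : ∀ X : Finset (Fin n), 4 ≤ X.card → X.card < 4 + t → Disjoint X S →
      (∃ A ∈ 𝒜, X ⊆ A) → ¬ IsTransversal F X)
    (hT : ∀ X : Finset (Fin n), X.card < 4 → Disjoint X S →
      ∃ T, IsTransversal F T ∧ Disjoint T X ∧ (T \ S).card ≤ f X.card) :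
    𝒜.card ≤ f 0 * f 1 * f 2 * f 3 * k ^ t * W := by
  have hF : ∀ A ∈ 𝒜, A ∈ F := fun A hA => (Finset.mem_filter.1 (h𝒜 hA)).1
  have h := card_le_prod_of_branching (𝒜 := 𝒜) (S := S) (s := 4 + t) (W := W)
    (e := fun i => if i < 4 then f i else k) (fun A hA => (Finset.mem_filter.1 (h𝒜 hA)).2)
    (fun X h1 h2 => (Finset.card_le_card (Finset.filter_subset_filter _ h𝒜)).trans (hW X h1 h2)) ?_
  · rw [Finset.prod_range_add] at h
    simpa [Finset.prod_range_succ] using h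
  · intro X h1 h2 h3
    by_cases h4 : X.card < 4
    · obtain ⟨T, hT1, hT2, hT3⟩ := hT X h4 h2
      exact ⟨T, fun A hA => hT1 A (hF A hA), hT2, by simpa [h4] using hT3⟩
    · obtain ⟨E, hE, hEX⟩ :=
        exists_mem_disjoint_of_not_isTransversal (hX X (by omega) h1 h2 h3)
      refine ⟨E, fun A hA => hint (hF A hA) hE, hEX, ?_⟩
      simp only [h4, if_false]
      exact (Finset.card_le_card Finset.sdiff_subset).trans
        (Finset.mem_powersetCard.1 (hunif hE)).2.le

/-- The bound when the first level `r` at which no triple meets all transversals of at most `r`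
points is at least `6`. -/
theorem card_avoiding_le_of_six_le {F : Finset (Finset (Fin n))} {S : Finset (Fin n)} {t : ℕ}
    (hunif : F ⊆ Finset.powersetCard k Finset.univ)
    (hint : (F : Set (Finset (Fin n))).Intersecting) (hn : 71 * k ^ 2 ≤ n) (ht : 2 ≤ t)
    (htk : 4 + t ≤ k) (hS : S.card = 3)
    (hST : ∀ T, IsTransversal F T → T.card < 4 + t → ¬ Disjoint T S)
    (hT : ∀ X : Finset (Fin n), X.card ≤ 3 →
      ∃ T, IsTransversal F T ∧ T.card ≤ 4 + t ∧ Disjoint T X) :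
    (avoiding F S).card ≤ 3 * (n - 7).choose (k - 4) := by
  have h := card_le_of_isTransversal (𝒜 := avoiding F S) (t := t)
    (W := (n - 3 - (4 + t)).choose (k - (4 + t))) (f := fun _ => 4 + t) hunif hint subset_rfl
    (fun X h1 h2 => h1 ▸ card_supersets_le hunif hS h2)
    (fun X _ h1 h2 _ h3 => hST X h3 h1 h2) (fun X h1 _ => by
      obtain ⟨T, hT1, hT2, hT3⟩ := hT X (by omega)
      exact ⟨T, hT1, hT3, (Finset.card_le_card Finset.sdiff_subset).trans hT2⟩)
  refine h.trans ?_
  calc (4 + t) * (4 + t) * (4 + t) * (4 + t) * k ^ t * (n - 3 - (4 + t)).choose (k - (4 + t))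
      = (4 + t) ^ 4 * (k ^ t * (n - 3 - (4 + t)).choose (k - (4 + t))) := by ring
    _ ≤ 3 * 71 ^ t * (k ^ t * (n - 3 - (4 + t)).choose (k - (4 + t))) :=
      Nat.mul_le_mul_right _ (pow_four_le t ht)
    _ = 3 * ((71 * k) ^ t * (n - 3 - (4 + t)).choose (k - (4 + t))) := by rw [mul_pow]; ring
    _ ≤ _ := Nat.mul_le_mul_left _ (pow_mul_choose_le hn t htk)

/-- The bound when some triple meets all transversals of at most `4` points, but none meets all
those of at most `5` points. If the transversals of at most `4` points share a point, the triple is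
taken inside a transversal `E` of at most `5` points, which leaves two points of `E` for the first
step. Otherwise the first two steps can use transversals of at most `4` points, each with a point in
the triple. -/
theorem exists_card_avoiding_le_of_five {F : Finset (Finset (Fin n))}
    (hunif : F ⊆ Finset.powersetCard k Finset.univ)
    (hint : (F : Set (Finset (Fin n))).Intersecting) (hn : 71 * k ^ 2 ≤ n) (hk : 5 ≤ k)
    (hF : ∀ T, IsTransversal F T → 4 ≤ T.card) {S₀ : Finset (Fin n)} (hS₀ : S₀.card = 3)
    (hST : ∀ T, IsTransversal F T → T.card ≤ 4 → ¬ Disjoint T S₀)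
    (hT : ∀ X : Finset (Fin n), X.card ≤ 3 →
      ∃ T, IsTransversal F T ∧ T.card ≤ 5 ∧ Disjoint T X) :
    ∃ S : Finset (Fin n), S.card = 3 ∧
      (avoiding F S).card ≤ 250 * k * (n - 8).choose (k - 5) := by
  have hW : ∀ S : Finset (Fin n), S.card = 3 → ∀ X : Finset (Fin n), X.card = 4 + 1 →
      Disjoint X S →
      ((avoiding F S).filter fun A => X ⊆ A).card ≤ (n - 8).choose (k - 5) := by
    intro S hS X h1 h2
    have := card_supersets_le hunif hS h2
    rwa [h1, show n - 3 - (4 + 1) = n - 8 by omega] at this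
  have hX : ∀ S : Finset (Fin n), (∀ T, IsTransversal F T → T.card ≤ 4 → ¬ Disjoint T S) →
      ∀ X : Finset (Fin n), 4 ≤ X.card → X.card < 4 + 1 → Disjoint X S →
      (∃ A ∈ avoiding F S, X ⊆ A) → ¬ IsTransversal F X :=
    fun S hS X _ h2 h3 _ h4 => hS X h4 (by omega) h3
  by_cases hx : ∃ x, ∀ T, IsTransversal F T → T.card ≤ 4 → x ∈ T
  · obtain ⟨x, hx⟩ := hx
    obtain ⟨E, S, hE, hE5, hSE, hS, hST'⟩ : ∃ E S : Finset (Fin n), IsTransversal F E ∧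
        E.card ≤ 5 ∧ S ⊆ E ∧ S.card = 3 ∧
        ∀ T, IsTransversal F T → T.card ≤ 4 → ¬ Disjoint T S := by
      by_cases hne : ∃ E, IsTransversal F E ∧ E.card ≤ 4
      · obtain ⟨E, hE, hE4⟩ := hne
        obtain ⟨S, h1, h2, h3⟩ := Finset.exists_subsuperset_card_eq (s := {x}) (t := E) (n := 3)
          (Finset.singleton_subset_iff.2 (hx E hE hE4)) (by simp)
          (by have := hF E hE; omega)
        exact ⟨E, S, hE, by omega, h2, h3, fun T h4 h5 =>
          Finset.not_disjoint_iff.2 ⟨x, hx T h4 h5, Finset.singleton_subset_iff.1 h1⟩⟩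
      · obtain ⟨E, hE, hE5, -⟩ := hT ∅ (by simp)
        obtain ⟨S, h1, h2⟩ := Finset.exists_subset_card_eq (s := E) (n := 3)
          (by have := hF E hE; omega)
        exact ⟨E, S, hE, hE5, h1, h2, fun T h4 h5 => (hne ⟨T, h4, h5⟩).elim⟩
    refine ⟨S, hS, ?_⟩
    have h := card_le_of_isTransversal (𝒜 := avoiding F S) (t := 1)
      (f := fun i => if i = 0 then 2 else 5) hunif hint subset_rfl (hW S hS) (hX S hST')
      (fun X h1 _ => by
        by_cases h0 : X = ∅
        · subst h0
          refine ⟨E, hE, Finset.disjoint_empty_right E, ?_⟩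
          rw [Finset.card_sdiff_of_subset hSE, Finset.card_empty, if_pos rfl]
          omega
        · obtain ⟨T, hT1, hT2, hT3⟩ := hT X (by omega)
          refine ⟨T, hT1, hT3, ?_⟩
          rw [if_neg (by rwa [Finset.card_eq_zero])]
          exact (Finset.card_le_card Finset.sdiff_subset).trans hT2)
    simpa using h
  · refine ⟨S₀, hS₀, ?_⟩
    have h := card_le_of_isTransversal (𝒜 := avoiding F S₀) (t := 1)
      (f := fun i => if i < 2 then 3 else 5) hunif hint subset_rfl (hW S₀ hS₀) (hX S₀ hST)
      (fun X h1 _ => by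
        by_cases h2 : X.card < 2
        · obtain ⟨x, hxX⟩ : ∃ x, X ⊆ {x} := by
            have : Nonempty (Fin n) := ⟨⟨0, by nlinarith⟩⟩
            exact Finset.card_le_one_iff_subset_singleton.1 (by omega)
          push Not at hx
          obtain ⟨T, hT1, hT2, hT3⟩ := hx x
          refine ⟨T, hT1, (Finset.disjoint_singleton_right.2 hT3).mono_right hxX, ?_⟩
          rw [if_pos h2]
          have := card_sdiff_add_one_le (hST T hT1 hT2)
          omega
        · obtain ⟨T, hT1, hT2, hT3⟩ := hT X (by omega)
          refine ⟨T, hT1, hT3, ?_⟩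
          rw [if_neg h2]
          exact (Finset.card_le_card Finset.sdiff_subset).trans hT2)
    simp at h
    refine h.trans (Nat.mul_le_mul_right _ (Nat.mul_le_mul_right _ (by norm_num)))

/-- The transversals of exactly four points. -/
noncomputable def fourTransversals (F : Finset (Finset (Fin n))) : Finset (Finset (Fin n)) := by
  classical exact Finset.univ.filter fun T => T.card = 4 ∧ IsTransversal F T

theorem mem_fourTransversals {F : Finset (Finset (Fin n))} {T : Finset (Fin n)} :
    T ∈ fourTransversals F ↔ T.card = 4 ∧ IsTransversal F T := by
  simp [fourTransversals]

/-- The bound when no triple meets all transversals of at most `4` points. The triple `S` is the one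
avoided by the fewest of the `4`-point transversals, hence by at most three. Members avoiding `S`
and containing one of those give the main term. For the others, minimality of `S` supplies in each
of the first three steps a `4`-point transversal with a point in `S`. -/
theorem exists_card_avoiding_le_of_four {F : Finset (Finset (Fin n))} {W : ℕ}
    (hunif : F ⊆ Finset.powersetCard k Finset.univ)
    (hint : (F : Set (Finset (Fin n))).Intersecting)
    (hmax : ∀ A : Finset (Fin n), A.card = k → IsTransversal F A → A ∈ F)
    (hk : 4 ≤ k) (hn : 71 * k ^ 2 ≤ n)
    (hF : ∀ T, IsTransversal F T → 4 ≤ T.card)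
    (hW : ∀ S X : Finset (Fin n), S.card = 3 → X.card = 4 + 1 → Disjoint X S →
      ((avoiding F S).filter fun A => X ⊆ A).card ≤ W)
    (hT : ∀ X : Finset (Fin n), X.card ≤ 3 →
      ∃ T, IsTransversal F T ∧ T.card ≤ 4 ∧ Disjoint T X) :
    ∃ S : Finset (Fin n), S.card = 3 ∧
      (avoiding F S).card ≤ 3 * (n - 7).choose (k - 4) + 108 * k * W := by
  classical
  have hkn : k + 4 ≤ n := by nlinarith
  set G := fourTransversals F with hG
  have hGT : ∀ X : Finset (Fin n), X.card ≤ 3 → ∃ T ∈ G, Disjoint T X := by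
    intro X hX
    obtain ⟨T, h1, h2, h3⟩ := hT X hX
    exact ⟨T, mem_fourTransversals.2 ⟨le_antisymm h2 (hF T h1), h1⟩, h3⟩
  obtain ⟨S, hS, hmin⟩ := Finset.exists_min_image
    (Finset.powersetCard 3 (Finset.univ : Finset (Fin n))) (fun S => (avoiding G S).card)
    (by rw [Finset.powersetCard_nonempty]; simp; omega)
  have hS3 : S.card = 3 := (Finset.mem_powersetCard.1 hS).2
  replace hmin : ∀ S' : Finset (Fin n), S'.card = 3 →
      (avoiding G S).card ≤ (avoiding G S').card :=
    fun S' h => hmin S' (Finset.mem_powersetCard.2 ⟨Finset.subset_univ _, h⟩)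
  have hthree : (avoiding G S).card ≤ 3 := by
    by_contra hlt
    have : Nonempty (Fin n) := ⟨⟨0, by omega⟩⟩
    refine not_spread G ⟨fun A hA => (mem_fourTransversals.1 hA).1, fun A hA B hB => ?_,
      fun x y z => ?_⟩
    · have hA' := mem_fourTransversals.1 hA
      have hB' := mem_fourTransversals.1 hB
      exact Finset.not_disjoint_iff.1
        (not_disjoint_of_isTransversal hmax hA'.2 hB'.2 (by omega) (by omega))
    · obtain ⟨S', h1, h2⟩ := exists_superset_card_three (n := n) (by omega)
        (X := {x, y, z}) Finset.card_le_three
      refine le_trans (le_trans (by omega) (hmin S' h2)) (Finset.card_le_card ?_)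
      refine Finset.monotone_filter_right _ fun A _ hA => ?_
      have := Finset.disjoint_right.1 (hA.mono_right h1)
      exact ⟨this (by simp), this (by simp), this (by simp)⟩
  -- otherwise enlarging `X` by a point of some transversal would contradict minimality of `S`
  have hmeet : ∀ X : Finset (Fin n), X.card ≤ 2 → ∃ T ∈ G, Disjoint T X ∧ ¬ Disjoint T S := by
    intro X hX
    by_contra! hcon
    obtain ⟨E, hE, hEX⟩ := hGT X (by omega)
    obtain ⟨y, hy⟩ : E.Nonempty := by
      rw [← Finset.card_pos, (mem_fourTransversals.1 hE).1]
      norm_num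
    obtain ⟨S', h1, h2⟩ := exists_superset_card_three (n := n) (by omega) (X := insert y X)
      ((Finset.card_insert_le _ _).trans (by omega))
    have hsub : avoiding G S' ⊆ avoiding G S := by
      intro T hT
      obtain ⟨hTG, hTS⟩ := Finset.mem_filter.1 hT
      exact Finset.mem_filter.2 ⟨hTG, hcon T hTG
        (hTS.mono_right ((Finset.subset_insert y X).trans h1))⟩
    have heq := Finset.eq_of_subset_of_card_le hsub (hmin S' h2)
    have hES : E ∈ avoiding G S' := by
      rw [heq]
      exact Finset.mem_filter.2 ⟨hE, hcon E hE hEX⟩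
    exact Finset.disjoint_left.1 (Finset.mem_filter.1 hES).2 hy
      (h1 (Finset.mem_insert_self y X))
  refine ⟨S, hS3, ?_⟩
  set 𝒜 := (avoiding F S).filter fun A => ∀ T ∈ G, ¬ T ⊆ A with h𝒜
  have hcov : avoiding F S ⊆
      ((avoiding G S).biUnion fun T => (avoiding F S).filter fun A => T ⊆ A) ∪ 𝒜 := by
    intro A hA
    by_cases h : ∀ T ∈ G, ¬ T ⊆ A
    · exact Finset.mem_union_right _ (Finset.mem_filter.2 ⟨hA, h⟩)
    · push Not at h
      obtain ⟨T, hTG, hTA⟩ := h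
      refine Finset.mem_union_left _ (Finset.mem_biUnion.2 ⟨T, Finset.mem_filter.2 ⟨hTG, ?_⟩,
        Finset.mem_filter.2 ⟨hA, hTA⟩⟩)
      exact (Finset.mem_filter.1 hA).2.mono_left hTA
  refine (Finset.card_le_card hcov).trans ((Finset.card_union_le _ _).trans (Nat.add_le_add ?_ ?_))
  · refine (Finset.card_biUnion_le_card_mul _ _ ((n - 7).choose (k - 4)) fun T hT => ?_).trans
      (Nat.mul_le_mul_right _ hthree)
    obtain ⟨hTG, hTS⟩ := Finset.mem_filter.1 hT
    have := card_supersets_le hunif hS3 hTS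
    rwa [(mem_fourTransversals.1 hTG).1, show n - 3 - 4 = n - 7 by omega] at this
  · have h := card_le_of_isTransversal (𝒜 := 𝒜) (t := 1) (W := W)
      (f := fun i => if i < 3 then 3 else 4) hunif hint (Finset.filter_subset _ _)
      (fun X => hW S X hS3)
      (fun X h1 h2 _ h3 h4 => by
        obtain ⟨A, hA, hXA⟩ := h3
        exact (Finset.mem_filter.1 hA).2 X (mem_fourTransversals.2 ⟨by omega, h4⟩) hXA)
      (fun X h1 _ => by
        by_cases h2 : X.card < 3
        · obtain ⟨T, hTG, hTX, hTS⟩ := hmeet X (by omega)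
          obtain ⟨h3, h4⟩ := mem_fourTransversals.1 hTG
          refine ⟨T, h4, hTX, ?_⟩
          have := card_sdiff_add_one_le hTS
          rw [if_pos h2]
          omega
        · obtain ⟨T, hTG, hTX⟩ := hGT X (by omega)
          obtain ⟨h3, h4⟩ := mem_fourTransversals.1 hTG
          refine ⟨T, h4, hTX, ?_⟩
          rw [if_neg h2, ← h3]
          exact Finset.card_le_card Finset.sdiff_subset)
    simpa using h

/-- The bound for a maximal family: for the least `r` such that no triple meets all transversals of
at most `r` points, the cases `r = 4`, `r = 5` and `r ≥ 6` are treated separately. -/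
theorem diversity_le_of_maximal {F : Finset (Finset (Fin n))}
    (hunif : F ⊆ Finset.powersetCard k Finset.univ)
    (hint : (F : Set (Finset (Fin n))).Intersecting)
    (hmax : ∀ A : Finset (Fin n), A.card = k → IsTransversal F A → A ∈ F)
    (hk : 4 ≤ k) (hn : 71 * k ^ 2 ≤ n) :
    diversity 3 F ≤
      3 * (n - 7).choose (k - 4) + 108 * k * binom (n - 8) ((k : ℤ) - 5) := by
  classical
  have hkn : k + 4 ≤ n := by nlinarith
  by_cases htriv : ∃ S : Finset (Fin n), S.card = 3 ∧ IsTransversal F S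
  · obtain ⟨S, hS, hST⟩ := htriv
    refine (diversity_le_card_avoiding F hS).trans ?_
    rw [show avoiding F S = ∅ from Finset.filter_eq_empty_iff.2 hST]
    simp
  have hF : ∀ T, IsTransversal F T → 4 ≤ T.card := by
    intro T hT
    by_contra! hlt
    obtain ⟨S, h1, h2⟩ := exists_superset_card_three (n := n) (by omega) (X := T) (by omega)
    exact htriv ⟨S, h2, fun A hA h => hT A hA (h.mono_right h1)⟩
  -- the first `r` for which no triple meets all transversals of at most `r` points
  let P : ℕ → Prop := fun r => ¬ ∃ S : Finset (Fin n), S.card = 3 ∧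
    ∀ T, IsTransversal F T → T.card ≤ r → ¬ Disjoint T S
  have hPk : P k := by
    rintro ⟨S, hS, hST⟩
    refine htriv ⟨S, hS, fun A hA => hST A (fun B hB => hint hB hA) ?_⟩
    exact (Finset.mem_powersetCard.1 (hunif hA)).2.le
  have hex : ∃ r, P r := ⟨k, hPk⟩
  obtain ⟨r, hr⟩ : ∃ r, r = Nat.find hex := ⟨_, rfl⟩
  have hrP : P r := hr ▸ Nat.find_spec hex
  have hrk : r ≤ k := hr ▸ Nat.find_min' hex hPk
  have hlt : ∀ q < r, ∃ S : Finset (Fin n), S.card = 3 ∧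
      ∀ T, IsTransversal F T → T.card ≤ q → ¬ Disjoint T S :=
    fun q hq => not_not.1 (Nat.find_min hex (hr ▸ hq))
  have hT : ∀ X : Finset (Fin n), X.card ≤ 3 →
      ∃ T, IsTransversal F T ∧ T.card ≤ r ∧ Disjoint T X := by
    intro X hX
    obtain ⟨S, h1, h2⟩ := exists_superset_card_three (n := n) (by omega) hX
    by_contra! hcon
    exact hrP ⟨S, h2, fun T h3 h4 h5 => hcon T h3 h4 (h5.mono_right h1)⟩
  have hr4 : 4 ≤ r := by
    obtain ⟨T, h1, h2, -⟩ := hT ∅ (by simp)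
    exact (hF T h1).trans h2
  rcases (by omega : r = 4 ∨ r = 5 ∨ 6 ≤ r) with rfl | rfl | hr6
  · have hW : ∀ S X : Finset (Fin n), S.card = 3 → X.card = 4 + 1 → Disjoint X S →
        ((avoiding F S).filter fun A => X ⊆ A).card ≤ binom (n - 8) ((k : ℤ) - 5) := by
      intro S X hS hX hXS
      by_cases hk5 : k < 5
      · rw [card_supersets_eq_zero hunif (by omega)]
        exact Nat.zero_le _
      · have := card_supersets_le hunif hS hXS
        rw [binom, if_neg (by omega), show ((k : ℤ) - 5).toNat = k - 5 by omega]
        rwa [hX, show n - 3 - (4 + 1) = n - 8 by omega] at this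
    obtain ⟨S, hS, hSF⟩ := exists_card_avoiding_le_of_four hunif hint hmax hk hn hF hW hT
    exact (diversity_le_card_avoiding F hS).trans hSF
  · obtain ⟨S₀, hS₀, hST⟩ := hlt 4 (by omega)
    obtain ⟨S, hS, hSF⟩ := exists_card_avoiding_le_of_five hunif hint hn hrk hF hS₀ hST hT
    refine (diversity_le_card_avoiding F hS).trans (hSF.trans ?_)
    have h := mul_choose_le (i := 4) hn (by omega) (by omega)
    rw [show n - 3 - (4 + 1) = n - 8 by omega, show n - 3 - 4 = n - 7 by omega] at h
    rw [binom, if_neg (by omega), show ((k : ℤ) - 5).toNat = k - 5 by omega]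
    have h' : 250 * k * (n - 8).choose (k - 5) ≤ 321 * (k * (n - 8).choose (k - 5)) := by
      rw [mul_assoc]
      exact Nat.mul_le_mul_right _ (by norm_num)
    linarith
  · obtain ⟨t, rfl⟩ : ∃ t, r = 4 + t := ⟨r - 4, by omega⟩
    obtain ⟨S, hS, hST⟩ := hlt (4 + t - 1) (by omega)
    have := card_avoiding_le_of_six_le hunif hint hn (by omega) hrk hS
      (fun T h1 h2 => hST T h1 (by omega)) hT
    exact (diversity_le_card_avoiding F hS).trans (this.trans (Nat.le_add_right _ _))

end TripleDiversity

theorem mainTheorem3 (n k : ℕ) (hk : 4 ≤ k) (hn : 71 * k ^ 2 ≤ n)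
    (F : Finset (Finset (Fin n)))
    (hunif : F ⊆ Finset.powersetCard k Finset.univ)
    (hint : (F : Set (Finset (Fin n))).Intersecting) :
    TripleDiversity.diversity 3 F ≤
      3 * TripleDiversity.binom (n - 7) ((k : ℤ) - 4)
        + 108 * k * TripleDiversity.binom (n - 8) ((k : ℤ) - 5) := by
  obtain ⟨F', hFF', hunif', hint', hmax⟩ :=
    TripleDiversity.exists_maximal_intersecting (by omega) F hunif hint
  have h := TripleDiversity.diversity_le_of_maximal hunif' hint' hmax hk hn
  have hb : TripleDiversity.binom (n - 7) ((k : ℤ) - 4) = (n - 7).choose (k - 4) := by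
    rw [TripleDiversity.binom, if_neg (by omega), show ((k : ℤ) - 4).toNat = k - 4 by omega]
  rw [hb]
  exact (TripleDiversity.diversity_mono (by nlinarith) hFF').trans h
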